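/- **Definitions.** A normal pair $(N,F)$ is a group $F$ with a normal subgroup $N$; a morphism $(N,F)\to(M,G)$ is a homomorphism $F\to G$ mapping $N$ into $M$. Let $U_F$ be the free group on symbols $u_x$ ($x\in F$) with the normalization $u_1=1$; put $J_F=\ker(U_F\to F,\ u_x\mapsto x)$, $U_{N,F}=\ker(U_F\to U_{F/N})$ and $J_{N,F}=U_{N,F}\cap J_F$. Define $$K_1(N,F)=N/[N,F],\qquad K^J_2(N,F)=\frac{J_{N,F}\cap[U_{N,F},U_F]}{[J_{N,F},U_F]\,[U_{N,F},J_F]},\qquad K^J_{k+2}(N,F)=K^J_2(J^k_{N,F},U^k_F),$$ where $(J^k_{N,F},U^k_F)$ is the $k$-th iterate of the suspension $(N,F)\mapsto(J_{N,F},U_F)$. For a normal pair $(P,E)$ put $\overline F=U_E/J_{P,E}$, and write $J_{E/P}$ and $P$ for the images of $J_E$ and $U_{P,E}$ in $\overline F$. The pair $(P,E)$ is *exact of first order* if $K^J_2(J_{E/P},\overline F)\to K^J_2(J_{E/P}\times P,\overline F)$ is injective, *exact of second order* if $(J_{E/P},\overline F)$ is exact of first order, and *fully exact* if both hold. The canonical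 $F$-central extension of $N$ is $\widetilde N=U_{N,F}/([J_{N,F},U_F][U_{N,F},J_F])$, on which $F$ acts through conjugation by $U_F$. For $[N,F]\subseteq N_0\subseteq N$ the pair $(N,F)$ is *partially admissible on $N_0$* if $\widetilde N$ contains an $F$-normal subgroup that contains $[\widetilde N,F]$ (the image of $[U_{N,F},U_F]$) and is an extension of $N_0$ by $K^J_2(N,F)$, i.e. it maps onto $N_0$ and meets the kernel of $\widetilde N\to N$ in $K^J_2(N,F)$. **Corollary 5.1.** Let $1\to(N,F)\xrightarrow{i}(M,F)\xrightarrow{p}(P,E)\to1$ be an extension of normal pairs, i.e. $N\subseteq M$ are normal in $F$, $E=F/N$ and $P=M/N$. There are boundary homomorphisms $\delta_*:K^J_{n+1}(P,E)\to K^J_n(N,F)$ ($n\ge2$) and $\delta_*:K^J_2(P,E)\to K_1(N,F)$, determined as follows. For $k\ge 0$ let $(C,U)$ be the mapping cone of $(J^k_{N,F},U^k_F)\to(J^k_{M,F},U^k_F)$, that is the pull-back of $(U_{J^k_{M,F},U^k_F},U^{k+1}_F)\to(J^k_{M,F},U^k_F)$ along this morphism; the composition of $K^J_2(C,U)\to K^J_2(J^{k+1}_{P,E},U^{k+1}_E)=K^J_{k+3}(P,E)$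 with $\delta_*$ is the map $K^J_2(C,U)\to K^J_{k+2}(N,F)$ induced by the projection of the cone. If $w\in[U_{M,F},U_F]$ evaluates to $a\in N$, then the second $\delta_*$ maps the class of the image of $w$ in $J_{P,E}\cap[U_{P,E},U_E]$ to the class of $a$. Consider the sequence $$\cdots\to K^J_{n+1}(P,E)\xrightarrow{\delta_*}K^J_n(N,F)\xrightarrow{i_*}K^J_n(M,F)\xrightarrow{p_*}K^J_n(P,E)\to\cdots\to K^J_2(P,E)\xrightarrow{\delta_*}K_1(N,F)\xrightarrow{i_*}K_1(M,F)\xrightarrow{p_*}K_1(P,E)\to0 .$$ 1. If $(N,F)$, $(M,F)$ and $(P,E)$ are fully exact, the sequence is exact. More precisely: * it is exact at $K^J_2(N,F)$ if $(P,E)$ is exact of first order; * it is exact at $K^J_3(P,E)$ if $(M,F)$ is exact of first order and $(P,E)$ is exact of second order; * it is exact at $K^J_3(M,F)$ if $(N,F)$ is exact of first order and $(M,F)$ is exact of second order; * it is exact at $K^J_3(N,F)$ if $(N,F)$ is exact of second order; * at all other places it is exact without any assumption. 2. The conditions on $(P,E)$ and $(N,F)$ are needed in the following sense. If for every extension with quotient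 $(P,E)$ the sequence is exact at $K^J_2(N,F)$, then $(P,E)$ is exact of first order; if for every extension with quotient $(P,E)$ and with $(M,F)$ exact of first order it is exact at $K^J_3(P,E)$, then $(P,E)$ is exact of second order. If for every extension with kernel $(N,F)$ and with $(M,F)$ exact of second order it is exact at $K^J_3(M,F)$, then $(N,F)$ is exact of first order; if for every extension with kernel $(N,F)$ it is exact at $K^J_3(N,F)$, then $(N,F)$ is exact of second order. 3. If $(N,F)$ is partially admissible on $N\cap[M,F]$, the sequence splits at $K^J_2(P,E)$: there is a projection of $K^J_2(P,E)$ onto the image of $K^J_2(M,F)$. -/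

import Mathlib

universe u

open scoped commutatorElement

/-! ### The normalized free cover of a group -/

/-- `U_F`: the free group on symbols `u_x`, `x ∈ F`, normalized by `u_1 = 1`; that is, the free
group on the nontrivial elements of `F`. -/
abbrev UGrp (F : Type u) [Group F] : Type u := FreeGroup {x : F // x ≠ 1}

namespace UGrp

variable {F G H : Type u} [Group F] [Group G] [Group H]

open Classical in
/-- The element `u_x` of `U_F`, with `u_1 = 1`. -/
noncomputable def u (x : F) : UGrp F := if h : x = 1 then 1 else FreeGroup.of ⟨x, h⟩

theorem u_one : u (1 : F) = 1 := by simp [u]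

/-- The evaluation `U_F → F`, `u_x ↦ x`. -/
noncomputable def ev : UGrp F →* F := FreeGroup.lift fun x => x.1

/-- The homomorphism `U_F → U_G`, `u_x ↦ u_{φ x}`, induced by `φ : F → G`. -/
noncomputable def map (φ : F →* G) : UGrp F →* UGrp G := FreeGroup.lift fun x => u (φ x.1)

theorem ev_u (x : F) : ev (u x) = x := by
  by_cases h : x = 1
  · simp [u, h]
  · simp [u, h, ev]

theorem map_u (φ : F →* G) (x : F) : map φ (u x) = u (φ x) := by
  by_cases h : x = 1
  · simp [h, u_one]
  · rw [u, dif_neg h, map, FreeGroup.lift_apply_of]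

theorem map_comp (ψ : G →* H) (φ : F →* G) : (map ψ).comp (map φ) = map (ψ.comp φ) := by
  apply FreeGroup.ext_hom
  intro x
  simp only [MonoidHom.comp_apply]
  rw [map, map, map, FreeGroup.lift_apply_of, FreeGroup.lift_apply_of]
  exact map_u ψ _

theorem map_map (ψ : G →* H) (φ : F →* G) (w : UGrp F) :
    map ψ (map φ w) = map (ψ.comp φ) w := DFunLike.congr_fun (map_comp ψ φ) w

theorem ev_map (φ : F →* G) (w : UGrp F) : ev (map φ w) = φ (ev w) := by
  have : ev.comp (map φ) = φ.comp ev := by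
    apply FreeGroup.ext_hom
    intro x
    simp only [MonoidHom.comp_apply]
    rw [map, FreeGroup.lift_apply_of, ev_u, ev, FreeGroup.lift_apply_of]
  exact DFunLike.congr_fun this w

end UGrp

/-! ### Normal pairs -/

/-- A normal pair `(N, F)`: a group `F` (the field `G`) with a normal subgroup `N`. -/
structure NormalPair : Type (u + 1) where
  G : Type u
  [group : Group G]
  N : Subgroup G
  [normal : N.Normal]

namespace NormalPair

attribute [instance] NormalPair.group NormalPair.normal

/-- A morphism of normal pairs `(N, F) → (M, G)`: a homomorphism `F → G` that maps `N` to `M`. -/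
structure Hom (A B : NormalPair.{u}) : Type u where
  toHom : A.G →* B.G
  mem : ∀ x ∈ A.N, toHom x ∈ B.N

/-- `U_{N,F}`, the kernel of `U_F → U_{F/N}`. -/
noncomputable def V (A : NormalPair.{u}) : Subgroup (UGrp A.G) :=
  (UGrp.map (QuotientGroup.mk' A.N)).ker

/-- `J_F`, the kernel of the evaluation `U_F → F`. -/
noncomputable def R (A : NormalPair.{u}) : Subgroup (UGrp A.G) := (UGrp.ev (F := A.G)).ker

/-- `J_{N,F}`, the kernel of the evaluation `U_{N,F} → N`. -/
noncomputable def J (A : NormalPair.{u}) : Subgroup (UGrp A.G) := A.V ⊓ A.R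

instance (A : NormalPair.{u}) : A.V.Normal := by unfold V; infer_instance
instance (A : NormalPair.{u}) : A.R.Normal := by unfold R; infer_instance
instance (A : NormalPair.{u}) : A.J.Normal := by unfold J; infer_instance

/-- The subgroup `[J_{N,F}, U_F] + [U_{N,F}, J_F]` of trivial elements. -/
noncomputable def T (A : NormalPair.{u}) : Subgroup (UGrp A.G) := ⁅A.J, ⊤⁆ ⊔ ⁅A.V, A.R⁆

instance (A : NormalPair.{u}) : A.T.Normal := by unfold T; infer_instance

/-- The subgroup `J_{N,F} ∩ [U_{N,F}, U_F]`. -/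
noncomputable def Z (A : NormalPair.{u}) : Subgroup (UGrp A.G) := A.J ⊓ ⁅A.V, ⊤⁆

/-- `K^J_2(N,F) = (J_{N,F} ∩ [U_{N,F}, U_F]) / ([J_{N,F}, U_F] + [U_{N,F}, J_F])`. -/
def K2 (A : NormalPair.{u}) : Type u := ↥A.Z ⧸ A.T.subgroupOf A.Z

/-- `K_1(N,F) = N / [N,F]`. -/
def K1 (A : NormalPair.{u}) : Type u := ↥A.N ⧸ (⁅A.N, (⊤ : Subgroup A.G)⁆).subgroupOf A.N

noncomputable instance (A : NormalPair.{u}) : CommGroup A.K2 :=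
  { (inferInstanceAs (Group (↥A.Z ⧸ A.T.subgroupOf A.Z)) : Group A.K2) with
    mul_comm := by
      intro a b
      induction a using QuotientGroup.induction_on with
      | H a =>
      induction b using QuotientGroup.induction_on with
      | H b =>
      refine QuotientGroup.eq.mpr ?_
      rw [Subgroup.mem_subgroupOf]
      have h : ⁅((b : UGrp A.G))⁻¹, ((a : UGrp A.G))⁻¹⁆ ∈ A.T :=
        (le_sup_left : ⁅A.J, ⊤⁆ ≤ A.T)
          (Subgroup.commutator_mem_commutator (A.J.inv_mem b.2.1) (Subgroup.mem_top _))
      simpa [commutatorElement_def, mul_assoc] using h }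

noncomputable instance (A : NormalPair.{u}) : CommGroup A.K1 :=
  { (inferInstanceAs (Group (↥A.N ⧸ (⁅A.N, (⊤ : Subgroup A.G)⁆).subgroupOf A.N)) :
      Group A.K1) with
    mul_comm := by
      intro a b
      induction a using QuotientGroup.induction_on with
      | H a =>
      induction b using QuotientGroup.induction_on with
      | H b =>
      refine QuotientGroup.eq.mpr ?_
      rw [Subgroup.mem_subgroupOf]
      have h : ⁅((b : A.G))⁻¹, ((a : A.G))⁻¹⁆ ∈ ⁅A.N, (⊤ : Subgroup A.G)⁆ :=
        Subgroup.commutator_mem_commutator (A.N.inv_mem b.2) (Subgroup.mem_top _)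
      simpa [commutatorElement_def, mul_assoc] using h }

/-- The class in `K^J_2(N,F)` of an element of `J_{N,F} ∩ [U_{N,F}, U_F]`. -/
noncomputable def K2.mk (A : NormalPair.{u}) : ↥A.Z →* A.K2 := QuotientGroup.mk' _

/-- The class in `K_1(N,F)` of an element of `N`. -/
noncomputable def K1.mk (A : NormalPair.{u}) : ↥A.N →* A.K1 := QuotientGroup.mk' _

/-! ### Functoriality -/

theorem Hom.map_V {A B : NormalPair.{u}} (f : Hom A B) : A.V ≤ B.V.comap (UGrp.map f.toHom) := by
  intro w hw
  have hw' : UGrp.map (QuotientGroup.mk' A.N) w = 1 := hw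
  change UGrp.map (QuotientGroup.mk' B.N) (UGrp.map f.toHom w) = 1
  have hc : (QuotientGroup.mk' B.N).comp f.toHom =
      (QuotientGroup.map A.N B.N f.toHom f.mem).comp (QuotientGroup.mk' A.N) := rfl
  rw [UGrp.map_map, hc, ← UGrp.map_map, hw', map_one]

theorem Hom.map_R {A B : NormalPair.{u}} (f : Hom A B) : A.R ≤ B.R.comap (UGrp.map f.toHom) := by
  intro w hw
  have hw' : UGrp.ev w = 1 := hw
  change UGrp.ev (UGrp.map f.toHom w) = 1
  rw [UGrp.ev_map, hw', map_one]

theorem Hom.map_J {A B : NormalPair.{u}} (f : Hom A B) : A.J ≤ B.J.comap (UGrp.map f.toHom) :=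
  fun _ hw => ⟨f.map_V hw.1, f.map_R hw.2⟩

theorem Hom.map_commutator {G H : Type u} [Group G] [Group H] (φ : G →* H) {K L : Subgroup G}
    {K' L' : Subgroup H} (hK : K ≤ K'.comap φ) (hL : L ≤ L'.comap φ) :
    ⁅K, L⁆ ≤ ⁅K', L'⁆.comap φ := by
  rw [← Subgroup.map_le_iff_le_comap, Subgroup.map_commutator]
  exact Subgroup.commutator_mono (Subgroup.map_le_iff_le_comap.mpr hK)
    (Subgroup.map_le_iff_le_comap.mpr hL)

theorem Hom.map_T {A B : NormalPair.{u}} (f : Hom A B) : A.T ≤ B.T.comap (UGrp.map f.toHom) :=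
  sup_le
    ((Hom.map_commutator _ f.map_J (fun _ _ => Subgroup.mem_top _)).trans
      (Subgroup.comap_mono le_sup_left))
    ((Hom.map_commutator _ f.map_V f.map_R).trans (Subgroup.comap_mono le_sup_right))

theorem Hom.map_Z {A B : NormalPair.{u}} (f : Hom A B) : A.Z ≤ B.Z.comap (UGrp.map f.toHom) :=
  fun _ hw => ⟨f.map_J hw.1,
    Hom.map_commutator _ f.map_V (fun _ _ => Subgroup.mem_top _) hw.2⟩

/-- The map on `K^J_2` induced by a morphism of normal pairs. -/
noncomputable def K2.map {A B : NormalPair.{u}} (f : Hom A B) : A.K2 →* B.K2 :=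
  QuotientGroup.map (A.T.subgroupOf A.Z) (B.T.subgroupOf B.Z)
    (((UGrp.map f.toHom).comp A.Z.subtype).codRestrict B.Z fun w => f.map_Z w.2)
    fun _ hw => f.map_T hw

/-- The map on `K_1` induced by a morphism of normal pairs. -/
noncomputable def K1.map {A B : NormalPair.{u}} (f : Hom A B) : A.K1 →* B.K1 :=
  QuotientGroup.map ((⁅A.N, (⊤ : Subgroup A.G)⁆).subgroupOf A.N)
    ((⁅B.N, (⊤ : Subgroup B.G)⁆).subgroupOf B.N)
    ((f.toHom.comp A.N.subtype).codRestrict B.N fun x => f.mem x.1 x.2)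
    fun _ hx => Hom.map_commutator f.toHom f.mem (fun _ _ => Subgroup.mem_top _) hx

/-! ### Suspensions and the higher groups -/

/-- The `J`-suspension `(J_{N,F}, U_F)`. -/
noncomputable def susp (A : NormalPair.{u}) : NormalPair.{u} := ⟨UGrp A.G, A.J⟩

/-- The morphism of suspensions induced by a morphism of pairs. -/
noncomputable def Hom.susp {A B : NormalPair.{u}} (f : Hom A B) :
    Hom (NormalPair.susp A) (NormalPair.susp B) :=
  ⟨UGrp.map f.toHom, f.map_J⟩

/-- The iterated suspension `(J^k_{N,F}, U^k_F)`. -/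
noncomputable def iterSusp : ℕ → NormalPair.{u} → NormalPair.{u}
  | 0, A => A
  | k + 1, A => susp (iterSusp k A)

/-- The morphism `(J^k_{N,F}, U^k_F) → (J^k_{M,G}, U^k_G)` induced by `(N,F) → (M,G)`. -/
noncomputable def Hom.iterSusp {A B : NormalPair.{u}} (f : Hom A B) :
    (k : ℕ) → Hom (NormalPair.iterSusp k A) (NormalPair.iterSusp k B)
  | 0 => f
  | k + 1 => Hom.susp (Hom.iterSusp f k)

/-- `KJ k A` is `K^J_{k+2}(N,F) = K^J_2(J^k_{N,F}, U^k_F)`; in particular `KJ 0 A = K2 A`. -/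
abbrev KJ (k : ℕ) (A : NormalPair.{u}) : Type u := K2 (iterSusp k A)

/-- The map on `K^J_{k+2}` induced by a morphism of normal pairs. -/
noncomputable abbrev KJ.map (k : ℕ) {A B : NormalPair.{u}} (f : Hom A B) : KJ k A →* KJ k B :=
  K2.map (f.iterSusp k)

/-! ### Exactness of first and second order -/

/-- The pair `(J_{E/P}, F̄)` derived from `(P,E)`, where `F̄ = U_E / J_{P,E} ≃ P ⋊ U_{E/P}` and
`J_{E/P}` is the image of `J_E` in `F̄`. -/
noncomputable def derived (C : NormalPair.{u}) : NormalPair.{u} :=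
  ⟨UGrp C.G ⧸ C.J, C.R.map (QuotientGroup.mk' C.J)⟩

/-- The pair `(J_{E/P} × P, F̄)`: here `P` is the image of `U_{P,E}` in `F̄ = U_E / J_{P,E}`, so
`J_{E/P} × P` is the image of the product of `J_E` and `U_{P,E}`. -/
noncomputable def derivedProd (C : NormalPair.{u}) : NormalPair.{u} :=
  ⟨UGrp C.G ⧸ C.J, (C.R ⊔ C.V).map (QuotientGroup.mk' C.J)⟩

/-- The inclusion `(J_{E/P}, F̄) ⊆ (J_{E/P} × P, F̄)`. -/
noncomputable def derivedIncl (C : NormalPair.{u}) : Hom C.derived C.derivedProd :=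
  ⟨MonoidHom.id (UGrp C.G ⧸ C.J), fun _ hx => Subgroup.map_mono le_sup_left hx⟩

/-- `(P,E)` is exact of first order: `K^J_2(J_{E/P}, F̄) → K^J_2(J_{E/P} × P, F̄)` is injective. -/
def ExactFirst (C : NormalPair.{u}) : Prop := Function.Injective (K2.map C.derivedIncl)

/-- `(P,E)` is exact of second order: its derived pair `(J_{E/P}, F̄)` is exact of first order. -/
def ExactSecond (C : NormalPair.{u}) : Prop := C.derived.ExactFirst

/-- `(P,E)` is fully exact: exact of first and of second order. -/
def FullyExact (C : NormalPair.{u}) : Prop := C.ExactFirst ∧ C.ExactSecond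

/-! ### Partial admissibility -/

/-- Let `[N,F] ≤ N₀ ≤ N`. The canonical `F`-central extension of `N` is the image `U_{N,F} / T` of
`U_{N,F}` in `U_F / T`, where `T = [J_{N,F}, U_F] + [U_{N,F}, J_F]`; the group `F` acts on it
through conjugation by `U_F`. The pair `(N,F)` is partially admissible on `N₀` if this extension
contains an `F`-normal subgroup `X`, containing the canonical commutator subgroup
`[U_{N,F}, U_F] / T`, that is an extension of `N₀` by `K^J_2(N,F)`. -/
def PartiallyAdmissible (A : NormalPair.{u}) (N₀ : Subgroup A.G) : Prop :=
  ∃ X : Subgroup (UGrp A.G ⧸ A.T),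
    X.Normal ∧
    X ≤ A.V.map (QuotientGroup.mk' A.T) ∧
    (⁅A.V, (⊤ : Subgroup (UGrp A.G))⁆).map (QuotientGroup.mk' A.T) ≤ X ∧
    X ⊓ A.J.map (QuotientGroup.mk' A.T) = A.Z.map (QuotientGroup.mk' A.T) ∧
    (X.comap (QuotientGroup.mk' A.T)).map UGrp.ev = N₀

/-! ### Extensions of normal pairs, mapping cones and boundary maps -/

/-- `1 → (N,F) → (M,F) → (P,E) → 1` is an extension of normal pairs: the first morphism identifies
the ambient groups, the second is surjective on the ambient groups with kernel `N`, and it maps `M`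
onto `P`. -/
structure IsExtension {A B C : NormalPair.{u}} (i : Hom A B) (p : Hom B C) : Prop where
  bijective : Function.Bijective i.toHom
  surjective : Function.Surjective p.toHom
  ker_eq : p.toHom.ker = A.N.map i.toHom
  map_eq : B.N.map p.toHom = C.N

/-- The ambient group `F ×_φ U_G` of the mapping cone of `φ : (N,F) → (M,G)`. -/
noncomputable def coneGroup {A B : NormalPair.{u}} (f : Hom A B) : Subgroup (A.G × UGrp B.G) :=
  MonoidHom.eqLocus (f.toHom.comp (MonoidHom.fst A.G (UGrp B.G)))
    (UGrp.ev.comp (MonoidHom.snd A.G (UGrp B.G)))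

/-- The mapping cone `(N ×_φ U_{M,G}, F ×_φ U_G)` of a morphism `φ : (N,F) → (M,G)`. -/
noncomputable def cone {A B : NormalPair.{u}} (f : Hom A B) : NormalPair.{u} :=
  ⟨↥(coneGroup f), (A.N.prod B.V).subgroupOf (coneGroup f)⟩

/-- The projection `(C_φ, U_φ) → (N,F)`. -/
noncomputable def coneFst {A B : NormalPair.{u}} (f : Hom A B) : Hom (cone f) A :=
  ⟨(MonoidHom.fst A.G (UGrp B.G)).comp (coneGroup f).subtype, fun _ hx => hx.1⟩

/-- The morphism `(C_i, U_i) → (J_{P,E}, U_E)` induced by `U_F → U_E`, for `(N,F) → (M,F) → (P,E)`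
such that the composition is trivial on `N`. -/
noncomputable def coneToSusp {A B C : NormalPair.{u}} (i : Hom A B) (p : Hom B C)
    (h : ∀ x ∈ A.N, p.toHom (i.toHom x) = 1) : Hom (cone i) (susp C) :=
  ⟨((UGrp.map p.toHom).comp (MonoidHom.snd A.G (UGrp B.G))).comp (coneGroup i).subtype, by
    intro x hx
    refine ⟨p.map_V hx.2, ?_⟩
    have hx' : i.toHom x.1.1 = UGrp.ev x.1.2 := x.2
    change UGrp.ev (UGrp.map p.toHom x.1.2) = 1
    rw [UGrp.ev_map, ← hx']
    exact h _ hx.1⟩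

theorem susp_comp_eq_one {A B C : NormalPair.{u}} (i : Hom A B) (p : Hom B C)
    (h : ∀ x ∈ A.N, p.toHom (i.toHom x) = 1) :
    ∀ w ∈ (susp A).N, p.susp.toHom (i.susp.toHom w) = 1 := by
  intro w hw
  have hw' : UGrp.map (QuotientGroup.mk' A.N) w = 1 := hw.1
  have hc : p.toHom.comp i.toHom =
      (QuotientGroup.lift A.N (p.toHom.comp i.toHom) h).comp (QuotientGroup.mk' A.N) := rfl
  have key : UGrp.map p.toHom (UGrp.map i.toHom (show UGrp A.G from w)) = 1 := by
    rw [UGrp.map_map, hc, ← UGrp.map_map]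
    exact (congrArg _ hw').trans (map_one _)
  exact key

theorem iterSusp_comp_eq_one {A B C : NormalPair.{u}} (i : Hom A B) (p : Hom B C)
    (h : ∀ x ∈ A.N, p.toHom (i.toHom x) = 1) (k : ℕ) :
    ∀ w ∈ (iterSusp k A).N, (p.iterSusp k).toHom ((i.iterSusp k).toHom w) = 1 := by
  induction k with
  | zero => exact h
  | succ k ih => exact susp_comp_eq_one _ _ ih

theorem IsExtension.comp_eq_one {A B C : NormalPair.{u}} {i : Hom A B} {p : Hom B C}
    (h : IsExtension i p) : ∀ x ∈ A.N, p.toHom (i.toHom x) = 1 := by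
  intro x hx
  have : i.toHom x ∈ p.toHom.ker := h.ker_eq ▸ Subgroup.mem_map_of_mem _ hx
  exact this

/-- `δ : K^J_{k+3}(P,E) → K^J_{k+2}(N,F)` is the boundary map: with `(C, U)` the mapping cone of
`(J^k_{N,F}, U^k_F) → (J^k_{M,F}, U^k_F)`, the composition of `δ` with
`K^J_2(C, U) → K^J_2(J^{k+1}_{P,E}, U^{k+1}_E) = K^J_{k+3}(P,E)` is the map
`K^J_2(C, U) → K^J_2(J^k_{N,F}, U^k_F) = K^J_{k+2}(N,F)` induced by the projection. -/
def IsBoundary {A B C : NormalPair.{u}} {i : Hom A B} {p : Hom B C} (h : IsExtension i p) (k : ℕ)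
    (δ : KJ (k + 1) C →* KJ k A) : Prop :=
  ∀ x : K2 (cone (i.iterSusp k)),
    δ (K2.map (coneToSusp (i.iterSusp k) (p.iterSusp k)
        (iterSusp_comp_eq_one i p h.comp_eq_one k)) x) =
      K2.map (coneFst (i.iterSusp k)) x

/-- `δ : K^J_2(P,E) → K_1(N,F)` is the boundary map: if `w ∈ [U_{M,F}, U_F]` evaluates to `a ∈ N`
and maps to `y ∈ J_{P,E} ∩ [U_{P,E}, U_E]`, then `δ` maps the class of `y` to the class of `a`. -/
def IsBoundaryOne {A B C : NormalPair.{u}} (i : Hom A B) (p : Hom B C) (δ : K2 C →* K1 A) : Prop :=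
  ∀ (w : UGrp B.G) (a : ↥A.N) (y : ↥C.Z), w ∈ ⁅B.V, (⊤ : Subgroup (UGrp B.G))⁆ →
    UGrp.ev w = i.toHom a → UGrp.map p.toHom w = y → δ (K2.mk C y) = K1.mk A a

end NormalPair

open NormalPair

/-! ### Lifting out of free groups and commutator subgroups -/

/-! Over a free ambient group, `K2` depends only on the quotient (`K2.map_bijective_of_free`). Hence
`rel A = (J_F, U_F)` computes an invariant of `F`, and `pull A`, the preimage of `N` in `U_F`,
computes the same invariant of `F / N`. For an extension with quotient `(P,E)` this gives `K2 (pull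
A) ≅ K2 (rel C)`, and the boundary is `K2 (susp C) → K2 (rel C) ≅ K2 (pull A) → K2 A`, the last map
being evaluation.

The sequence of an extension is exact from `K2` of the kernel down to `K_1` by commutator calculus,
since `U_F → U_E` splits. The composite `K2 (susp A) → K2 (rel A) → K2 (pull A)` is always trivial.
First order exactness says that it is exact in the middle (`exactFirst_iff`), second order exactness
that its first map is injective (`exactSecond_iff`). With these reformulations, exactness at the
remaining places below degree four is a diagram chase.

The main input is that `K2 (susp A)` vanishes for free `N` (`K2.susp_eq_one`). The canonical central
extension is a crossed module over a free group whose quotient is free-by-free. Such a quotient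
carries no third cohomological obstruction, so the crossed module comes from a group extension of a
free group, and a splitting of that extension kills `K2` (`eq_one_of_crossedModule`). As subgroups
of free groups are free, all `K^J_n` with `n ≥ 4` vanish.

The converses test special extensions: `derivedProd` and `pull` over `(P,E)`, and the extension of
`(F/N, F/N)` by `(N,F)`. The splitting uses that `K2` is a direct factor of `J` modulo trivial
elements, the complementary quotient being a subgroup of a free abelian group
(`exists_retraction_J`). -/

theorem IsFreeGroup.exists_lift {G H K : Type*} [Group G] [Group H] [Group K] [IsFreeGroup G]
    (f : H →* K) (g : G →* K) (h : ∀ x, ∃ y, f y = g x) : ∃ l : G →* H, ∀ x, f (l x) = g x := by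
  choose c hc using h
  refine ⟨IsFreeGroup.lift fun a => c (IsFreeGroup.of a), fun x => ?_⟩
  have : f.comp (IsFreeGroup.lift fun a => c (IsFreeGroup.of a)) = g := by
    apply IsFreeGroup.ext_hom
    intro a
    simp [hc]
  exact DFunLike.congr_fun this x

/-- Only commutators of values are compared, so `f` and `g` may differ on `K` and `L` themselves by
factors that commutators do not see. -/
theorem MonoidHom.eq_of_mem_commutator {G H : Type*} [Group G] [Group H] (f g : G →* H)
    {K L : Subgroup G} (h : ∀ k ∈ K, ∀ l ∈ L, ⁅f k, f l⁆ = ⁅g k, g l⁆) {w : G} (hw : w ∈ ⁅K, L⁆) :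
    f w = g w := by
  have : ⁅K, L⁆ ≤ f.eqLocus g := by
    rw [Subgroup.commutator_le]
    intro k hk l hl
    change f _ = g _
    rw [map_commutatorElement, map_commutatorElement, h k hk l hl]
  exact this hw

/-- The asymmetry between `a` and `b` fits computations modulo `T`, where `J` is central but `R` is
only known to commute with `V`. -/
theorem commutatorElement_mul_mul_of_commute {G : Type*} [Group G] {a b x y : G}
    (ha : ∀ g, Commute a g) (hb : Commute b x) (hb' : Commute b ⁅x, y⁆) :
    ⁅a * x, b * y⁆ = ⁅x, y⁆ := by
  have h1 : ⁅a * x, b * y⁆ = ⁅x, b * y⁆ := by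
    have h0 : ⁅a * x, b * y⁆ = (a * (x * (b * y) * x⁻¹)) * a⁻¹ * (b * y)⁻¹ := by
      simp only [commutatorElement_def]; group
    rw [h0, (ha _).eq, commutatorElement_def]
    group
  rw [h1]
  have h2 : ⁅x, b * y⁆ = (x * b * x⁻¹ * b⁻¹) * (b * ⁅x, y⁆ * b⁻¹) := by
    simp only [commutatorElement_def]; group
  rw [h2, hb'.eq, ← hb.eq]
  group

theorem Subgroup.mk_commute_of_commutator_le {G : Type*} [Group G] {K L T : Subgroup G} [T.Normal]
    (h : ⁅K, L⁆ ≤ T) {k l : G} (hk : k ∈ K) (hl : l ∈ L) :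
    Commute (QuotientGroup.mk' T k) (QuotientGroup.mk' T l) := by
  have : QuotientGroup.mk' T ⁅k, l⁆ = 1 :=
    (QuotientGroup.eq_one_iff _).mpr (h (Subgroup.commutator_mem_commutator hk hl))
  rw [map_commutatorElement] at this
  exact commutatorElement_eq_one_iff_commute.mp this

/-- For a split epimorphism with kernel `K` one has `K ∩ [G,G] ≤ [K,G]`. -/
theorem MonoidHom.ker_inf_commutator_le {G H : Type*} [Group G] [Group H] (f : G →* H) (s : H →* G)
    (hs : ∀ x, f (s x) = x) : f.ker ⊓ ⁅(⊤ : Subgroup G), ⊤⁆ ≤ ⁅f.ker, ⊤⁆ := by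
  rintro w ⟨hw, hw'⟩
  have hk : ∀ x, x * (s (f x))⁻¹ ∈ f.ker := fun x => by simp [MonoidHom.mem_ker, hs]
  have hc : ∀ k ∈ f.ker, ∀ g, Commute (QuotientGroup.mk' ⁅f.ker, ⊤⁆ k) g := by
    intro k hk g
    obtain ⟨g, rfl⟩ := QuotientGroup.mk'_surjective _ g
    exact Subgroup.mk_commute_of_commutator_le le_rfl hk (Subgroup.mem_top _)
  -- Modulo `[K,G]` the kernel is central, so `x` and `s (f x)` differ by a central factor and have
  -- the same commutators.
  have := (QuotientGroup.mk' ⁅f.ker, ⊤⁆).eq_of_mem_commutator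
    ((QuotientGroup.mk' ⁅f.ker, ⊤⁆).comp (s.comp f)) (K := ⊤) (L := ⊤) (fun k _ l _ => by
      have e : ∀ x, QuotientGroup.mk' ⁅f.ker, ⊤⁆ x =
          QuotientGroup.mk' ⁅f.ker, ⊤⁆ (x * (s (f x))⁻¹) *
          QuotientGroup.mk' ⁅f.ker, ⊤⁆ (s (f x)) := fun x => by rw [← map_mul]; simp
      rw [e k, e l]
      exact commutatorElement_mul_mul_of_commute (hc _ (hk k)) (hc _ (hk l) _) (hc _ (hk l) _)) hw'
  rw [← QuotientGroup.eq_one_iff]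
  change QuotientGroup.mk' ⁅f.ker, ⊤⁆ w = 1
  rw [this]
  simp [MonoidHom.mem_ker.mp hw]

/-! ### The free cover -/

namespace UGrp

variable {F G : Type u} [Group F] [Group G]

theorem ev_surjective : Function.Surjective (ev : UGrp F →* F) := fun x => ⟨u x, ev_u x⟩

theorem hom_ext {H : Type*} [Group H] {f g : UGrp F →* H} (h : ∀ x, f (u x) = g (u x)) : f = g := by
  apply FreeGroup.ext_hom
  rintro ⟨x, hx⟩
  have := h x
  rwa [u, dif_neg hx] at this

theorem map_id : map (MonoidHom.id F) = MonoidHom.id (UGrp F) :=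
  hom_ext fun x => by rw [map_u]; rfl

theorem map_surjective {φ : F →* G} (h : Function.Surjective φ) :
    Function.Surjective (map φ) := by
  rw [← MonoidHom.range_eq_top, eq_top_iff]
  intro w _
  induction w using FreeGroup.induction_on with
  | C1 => exact one_mem _
  | of x =>
    obtain ⟨y, hy⟩ := h x.1
    refine ⟨u y, ?_⟩
    rw [map_u, hy, u, dif_neg x.2]
  | inv_of x hx => exact inv_mem (hx trivial)
  | mul x y hx hy => exact mul_mem (hx trivial) (hy trivial)

theorem map_injective {φ : F →* G} (h : Function.Injective φ) : Function.Injective (map φ) := by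
  have : map φ = FreeGroup.map fun x : {x : F // x ≠ 1} =>
      (⟨φ x.1, fun e => x.2 (h (e.trans (map_one φ).symm))⟩ : {y : G // y ≠ 1}) := by
    apply FreeGroup.ext_hom
    intro x
    rw [map, FreeGroup.lift_apply_of, FreeGroup.map.of, u, dif_neg]
  rw [this]
  apply FreeGroup.map_injective
  intro x y e
  exact Subtype.ext (h (congrArg Subtype.val e))

/-- Each map factors through an injection of the quotient by its kernel, and `U` preserves
injectivity. Thus `U_{N,F}` can be tested on any homomorphism with kernel `N`. -/
theorem map_eq_one_iff_of_ker_eq {H : Type u} [Group H] {φ : F →* G} {ψ : F →* H}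
    (h : φ.ker = ψ.ker) (w : UGrp F) : map φ w = 1 ↔ map ψ w = 1 := by
  have aux : ∀ {K : Type u} [Group K] (χ : F →* K),
      map χ w = 1 ↔ map (QuotientGroup.mk' χ.ker) w = 1 := by
    intro K _ χ
    have e : χ = (QuotientGroup.kerLift χ).comp (QuotientGroup.mk' χ.ker) := rfl
    conv_lhs => rw [e]
    rw [← map_map, map_eq_one_iff _ (map_injective (QuotientGroup.kerLift_injective χ))]
  rw [aux φ, aux ψ]
  have : ∀ (K L : Subgroup F) [K.Normal] [L.Normal], K = L →
      (map (QuotientGroup.mk' K) w = 1 ↔ map (QuotientGroup.mk' L) w = 1) := by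
    intro K L _ _ e
    subst e
    rfl
  exact this _ _ h

end UGrp

namespace NormalPair

variable {A B C D : NormalPair.{u}}

/-! ### Functoriality of `K2` and `K1` -/

/-- Composition of morphisms of normal pairs. -/
def Hom.comp (g : Hom B C) (f : Hom A B) : Hom A C :=
  ⟨g.toHom.comp f.toHom, fun x hx => g.mem _ (f.mem x hx)⟩

theorem K2.mk_surjective (A : NormalPair.{u}) : Function.Surjective (K2.mk A) :=
  QuotientGroup.mk'_surjective _

theorem K1.mk_surjective (A : NormalPair.{u}) : Function.Surjective (K1.mk A) :=
  QuotientGroup.mk'_surjective _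

theorem K2.mk_eq_one_iff {z : A.Z} : K2.mk A z = 1 ↔ (z : UGrp A.G) ∈ A.T :=
  (QuotientGroup.eq_one_iff z).trans Subgroup.mem_subgroupOf

theorem K1.mk_eq_one_iff {a : A.N} : K1.mk A a = 1 ↔ (a : A.G) ∈ ⁅A.N, (⊤ : Subgroup A.G)⁆ :=
  (QuotientGroup.eq_one_iff a).trans Subgroup.mem_subgroupOf

theorem K2.mk_eq_mk_iff {z z' : A.Z} :
    K2.mk A z = K2.mk A z' ↔ (z : UGrp A.G) * (z' : UGrp A.G)⁻¹ ∈ A.T := by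
  rw [← div_eq_one, ← map_div, K2.mk_eq_one_iff, div_eq_mul_inv]
  rfl

theorem K1.mk_eq_mk_iff {a b : A.N} :
    K1.mk A a = K1.mk A b ↔ (a : A.G) * (b : A.G)⁻¹ ∈ ⁅A.N, (⊤ : Subgroup A.G)⁆ := by
  rw [← div_eq_one, ← map_div, K1.mk_eq_one_iff, div_eq_mul_inv]
  rfl

theorem K2.map_mk (f : Hom A B) (z : A.Z) :
    K2.map f (K2.mk A z) = K2.mk B ⟨UGrp.map f.toHom z, f.map_Z z.2⟩ := rfl

theorem K1.map_mk (f : Hom A B) (a : A.N) :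
    K1.map f (K1.mk A a) = K1.mk B ⟨f.toHom a, f.mem a a.2⟩ := rfl

theorem K2.map_map_eq {B' : NormalPair.{u}} {f : Hom A B} {g : Hom B C} {f' : Hom A B'}
    {g' : Hom B' C} (h : ∀ x, g.toHom (f.toHom x) = g'.toHom (f'.toHom x)) (x : A.K2) :
    K2.map g (K2.map f x) = K2.map g' (K2.map f' x) := by
  obtain ⟨z, rfl⟩ := K2.mk_surjective A x
  have e : g.toHom.comp f.toHom = g'.toHom.comp f'.toHom := MonoidHom.ext h
  simp only [K2.map_mk, UGrp.map_map, e]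

theorem K2.map_map_eq_map {f : Hom A B} {g : Hom B C} {k : Hom A C}
    (h : ∀ x, g.toHom (f.toHom x) = k.toHom x) (x : A.K2) :
    K2.map g (K2.map f x) = K2.map k x := by
  obtain ⟨z, rfl⟩ := K2.mk_surjective A x
  have e : g.toHom.comp f.toHom = k.toHom := MonoidHom.ext h
  simp only [K2.map_mk, UGrp.map_map, e]

theorem K2.map_map_eq_self {f : Hom A B} {g : Hom B A} (h : ∀ x, g.toHom (f.toHom x) = x)
    (x : A.K2) : K2.map g (K2.map f x) = x := by
  obtain ⟨z, rfl⟩ := K2.mk_surjective A x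
  have e : g.toHom.comp f.toHom = MonoidHom.id A.G := MonoidHom.ext h
  simp only [K2.map_mk, UGrp.map_map, e, UGrp.map_id, MonoidHom.id_apply]

theorem map_eq_one_of_mem_V {H : Type u} [Group H] {f : A.G →* H} (h : ∀ x ∈ A.N, f x = 1)
    {w : UGrp A.G} (hw : w ∈ A.V) : UGrp.map f w = 1 := by
  have hw' : UGrp.map (QuotientGroup.mk' A.N) w = 1 := hw
  have hc : f = (QuotientGroup.lift A.N f h).comp (QuotientGroup.mk' A.N) := rfl
  rw [hc, ← UGrp.map_map, hw', map_one]

theorem K2.map_eq_one {f : Hom A B} (h : ∀ x ∈ A.N, f.toHom x = 1) (x : A.K2) :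
    K2.map f x = 1 := by
  obtain ⟨z, rfl⟩ := K2.mk_surjective A x
  rw [K2.map_mk, K2.mk_eq_one_iff]
  change UGrp.map f.toHom (z : UGrp A.G) ∈ B.T
  rw [map_eq_one_of_mem_V h z.2.1.1]
  exact one_mem _

theorem K2.map_bijective_of_bijective {f : Hom A B} (hf : Function.Bijective f.toHom)
    (hN : ∀ x, f.toHom x ∈ B.N → x ∈ A.N) : Function.Bijective (K2.map f) := by
  let e := MulEquiv.ofBijective f.toHom hf
  have he : ∀ y, f.toHom (e.symm y) = y := e.apply_symm_apply
  have he' : ∀ x, e.symm (f.toHom x) = x := e.symm_apply_apply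
  let g : Hom B A := ⟨e.symm.toMonoidHom, fun y hy => hN _ (by
    change f.toHom (e.symm y) ∈ B.N
    rwa [he])⟩
  exact Function.bijective_iff_has_inverse.mpr
    ⟨K2.map g, K2.map_map_eq_self he', K2.map_map_eq_self he⟩

/-! ### Elementary facts about the subgroups `V`, `R`, `J`, `T` -/

theorem commutator_V_le : ⁅A.V, (⊤ : Subgroup (UGrp A.G))⁆ ≤ A.V := Subgroup.commutator_le_left _ _

theorem J_commutator_le_T : ⁅A.J, (⊤ : Subgroup (UGrp A.G))⁆ ≤ A.T := le_sup_left

theorem V_commutator_R_le_T : ⁅A.V, A.R⁆ ≤ A.T := le_sup_right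

theorem T_le_commutator : A.T ≤ ⁅A.V, (⊤ : Subgroup (UGrp A.G))⁆ :=
  sup_le (Subgroup.commutator_mono inf_le_left le_rfl) (Subgroup.commutator_mono le_rfl le_top)

theorem T_le_J : A.T ≤ A.J :=
  sup_le (Subgroup.commutator_le_left _ _)
    (le_inf (Subgroup.commutator_le_left _ _) (Subgroup.commutator_le_right _ _))

theorem ev_mem_of_mem_V {w : UGrp A.G} (hw : w ∈ A.V) : UGrp.ev w ∈ A.N := by
  have hw' : UGrp.map (QuotientGroup.mk' A.N) w = 1 := hw
  rw [← QuotientGroup.eq_one_iff]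
  change QuotientGroup.mk' A.N _ = 1
  rw [← UGrp.ev_map, hw', map_one]

theorem u_mem_V {x : A.G} (hx : x ∈ A.N) : UGrp.u x ∈ A.V := by
  change UGrp.map (QuotientGroup.mk' A.N) (UGrp.u x) = 1
  have : QuotientGroup.mk' A.N x = 1 := (QuotientGroup.eq_one_iff x).mpr hx
  rw [UGrp.map_u, this, UGrp.u_one]

theorem map_ev_V (A : NormalPair.{u}) : A.V.map UGrp.ev = A.N := by
  apply le_antisymm
  · rintro _ ⟨w, hw, rfl⟩
    exact ev_mem_of_mem_V hw
  · intro x hx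
    exact ⟨UGrp.u x, u_mem_V hx, UGrp.ev_u x⟩

theorem map_ev_commutator (A : NormalPair.{u}) :
    (⁅A.V, (⊤ : Subgroup (UGrp A.G))⁆).map UGrp.ev = ⁅A.N, (⊤ : Subgroup A.G)⁆ := by
  rw [Subgroup.map_commutator, map_ev_V, Subgroup.map_top_of_surjective _ UGrp.ev_surjective]

theorem R_sup_V (A : NormalPair.{u}) : A.R ⊔ A.V = A.N.comap UGrp.ev := by
  rw [← map_ev_V, Subgroup.comap_map_eq, sup_comm]
  rfl

theorem exists_ev_mul_eq_one (p : Hom B C) {w : UGrp B.G} (hw : p.toHom (UGrp.ev w) = 1) :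
    ∃ l ∈ (UGrp.map p.toHom).ker, UGrp.ev (w * l) = 1 := by
  have : (UGrp.ev w)⁻¹ ∈ p.toHom.ker := inv_mem hw
  refine ⟨UGrp.u (UGrp.ev w)⁻¹, ?_, by rw [map_mul, UGrp.ev_u, mul_inv_cancel]⟩
  rw [MonoidHom.mem_ker, UGrp.map_u, MonoidHom.mem_ker.mp this, UGrp.u_one]

/-! ### The exact sequence of an extension in low degrees -/

namespace IsExtension

variable {i : Hom A B} {p : Hom B C}

theorem mem_of_apply_mem (h : IsExtension i p) {x : B.G} (hx : p.toHom x ∈ C.N) : x ∈ B.N := by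
  rw [← h.map_eq] at hx
  obtain ⟨y, hy, e⟩ := hx
  have : x * y⁻¹ ∈ p.toHom.ker := by simp [MonoidHom.mem_ker, e]
  rw [h.ker_eq] at this
  obtain ⟨a, ha, e'⟩ := this
  have := mul_mem (i.mem a ha) hy
  rwa [e', inv_mul_cancel_right] at this

theorem mem_iff (h : IsExtension i p) {x : A.G} : x ∈ A.N ↔ p.toHom (i.toHom x) = 1 := by
  refine ⟨h.comp_eq_one x, fun hx => ?_⟩
  have : i.toHom x ∈ p.toHom.ker := hx
  rw [h.ker_eq] at this
  obtain ⟨a, ha, e⟩ := this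
  rwa [← h.bijective.1 e]

theorem mem_V_iff (h : IsExtension i p) {w : UGrp A.G} :
    w ∈ A.V ↔ UGrp.map p.toHom (UGrp.map i.toHom w) = 1 := by
  rw [UGrp.map_map]
  apply UGrp.map_eq_one_iff_of_ker_eq
  rw [QuotientGroup.ker_mk']
  ext x
  exact h.mem_iff

theorem map_V_eq (h : IsExtension i p) : A.V.map (UGrp.map i.toHom) = (UGrp.map p.toHom).ker := by
  ext w
  obtain ⟨w, rfl⟩ := UGrp.map_surjective h.bijective.2 w
  rw [MonoidHom.mem_ker, ← h.mem_V_iff,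
    Subgroup.mem_map_iff_mem (UGrp.map_injective h.bijective.1)]

theorem mem_V_iff_map (h : IsExtension i p) {w : UGrp B.G} :
    w ∈ B.V ↔ UGrp.map p.toHom w ∈ C.V := by
  refine ⟨fun hw => p.map_V hw, fun hw => ?_⟩
  have hw' : UGrp.map (QuotientGroup.mk' C.N) (UGrp.map p.toHom w) = 1 := hw
  rw [UGrp.map_map] at hw'
  refine (UGrp.map_eq_one_iff_of_ker_eq ?_ w).mp hw'
  rw [QuotientGroup.ker_mk']
  ext x
  rw [MonoidHom.mem_ker]
  change QuotientGroup.mk' C.N (p.toHom x) = 1 ↔ _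
  exact (QuotientGroup.eq_one_iff _).trans ⟨h.mem_of_apply_mem, p.mem x⟩

theorem map_map_V (h : IsExtension i p) : B.V.map (UGrp.map p.toHom) = C.V := by
  apply le_antisymm (Subgroup.map_le_iff_le_comap.mpr p.map_V)
  intro w hw
  obtain ⟨w, rfl⟩ := UGrp.map_surjective h.surjective w
  exact ⟨w, h.mem_V_iff_map.mpr hw, rfl⟩

theorem map_map_R (h : IsExtension i p) : B.R.map (UGrp.map p.toHom) = C.R := by
  apply le_antisymm (Subgroup.map_le_iff_le_comap.mpr p.map_R)
  intro w hw
  obtain ⟨w, rfl⟩ := UGrp.map_surjective h.surjective w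
  obtain ⟨l, hl, hl'⟩ := exists_ev_mul_eq_one p ((UGrp.ev_map _ _).symm.trans hw)
  exact ⟨w * l, hl', by rw [map_mul, MonoidHom.mem_ker.mp hl, mul_one]⟩

theorem map_map_J (h : IsExtension i p) : B.J.map (UGrp.map p.toHom) = C.J := by
  apply le_antisymm (Subgroup.map_le_iff_le_comap.mpr p.map_J)
  intro w hw
  obtain ⟨hv, hw⟩ := hw
  rw [SetLike.mem_coe, ← h.map_map_R] at hw
  obtain ⟨w, hw, rfl⟩ := hw
  exact ⟨w, ⟨h.mem_V_iff_map.mpr hv, hw⟩, rfl⟩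

theorem map_map_commutator (h : IsExtension i p) :
    (⁅B.V, (⊤ : Subgroup (UGrp B.G))⁆).map (UGrp.map p.toHom) =
    ⁅C.V, (⊤ : Subgroup (UGrp C.G))⁆ := by
  rw [Subgroup.map_commutator, h.map_map_V,
    Subgroup.map_top_of_surjective _ (UGrp.map_surjective h.surjective)]

theorem map_map_T (h : IsExtension i p) : B.T.map (UGrp.map p.toHom) = C.T := by
  rw [T, T, Subgroup.map_sup, Subgroup.map_commutator, Subgroup.map_commutator, h.map_map_V,
    h.map_map_J, h.map_map_R,
    Subgroup.map_top_of_surjective _ (UGrp.map_surjective h.surjective)]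

/-- `U_F → U_E` is a split epimorphism with kernel `U_{N,F}`, because `U_E` is free. This is what
makes the sequence exact in low degrees. -/
theorem mem_map_commutator (h : IsExtension i p) {w : UGrp B.G} (hw : UGrp.map p.toHom w = 1)
    (hw' : w ∈ ⁅B.V, (⊤ : Subgroup (UGrp B.G))⁆) :
    w ∈ (⁅A.V, (⊤ : Subgroup (UGrp A.G))⁆).map (UGrp.map i.toHom) := by
  obtain ⟨s, hs⟩ := IsFreeGroup.exists_lift (UGrp.map p.toHom) (MonoidHom.id _)
    (UGrp.map_surjective h.surjective)
  rw [Subgroup.map_commutator, h.map_V_eq,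
    Subgroup.map_top_of_surjective _ (UGrp.map_surjective h.bijective.2)]
  exact MonoidHom.ker_inf_commutator_le _ s hs ⟨hw, Subgroup.commutator_mono le_top le_rfl hw'⟩

/-- A trivial element over `E` lifts to a trivial element `t` over `F`. Dividing by `t` leaves a
commutator that dies in `U_E` and therefore comes from `(N,F)`. -/
theorem exact_K2 (h : IsExtension i p) : Function.MulExact (K2.map i) (K2.map p) := by
  intro y
  constructor
  · intro hy
    obtain ⟨w, rfl⟩ := K2.mk_surjective B y
    rw [K2.map_mk, K2.mk_eq_one_iff] at hy
    change UGrp.map p.toHom (w : UGrp B.G) ∈ C.T at hy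
    rw [← h.map_map_T] at hy
    obtain ⟨t, ht, e⟩ := hy
    obtain ⟨z, hz, hz'⟩ := h.mem_map_commutator (w := t⁻¹ * w)
      (by rw [map_mul, map_inv, e, inv_mul_cancel])
      (mul_mem (inv_mem (T_le_commutator ht)) w.2.2)
    have hzR : z ∈ A.R := by
      apply h.bijective.1
      rw [← UGrp.ev_map, hz', map_one]
      exact B.R.mul_mem (B.R.inv_mem (T_le_J ht).2) w.2.1.2
    refine ⟨K2.mk A ⟨z, ⟨commutator_V_le hz, hzR⟩, hz⟩, ?_⟩
    rw [K2.map_mk, K2.mk_eq_mk_iff]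
    change UGrp.map i.toHom z * (w : UGrp B.G)⁻¹ ∈ B.T
    rw [hz', mul_inv_cancel_right]
    exact inv_mem ht
  · rintro ⟨x, rfl⟩
    rw [K2.map_map_eq_map (k := p.comp i) (fun _ => rfl)]
    exact K2.map_eq_one h.comp_eq_one x

theorem exists_lift_Z (h : IsExtension i p) {y : UGrp C.G} (hy : y ∈ C.Z) :
    ∃ w ∈ ⁅B.V, (⊤ : Subgroup (UGrp B.G))⁆, UGrp.map p.toHom w = y ∧
      ∃ a ∈ A.N, UGrp.ev w = i.toHom a := by
  have hy' := hy.2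
  rw [← h.map_map_commutator] at hy'
  obtain ⟨w, hw, rfl⟩ := hy'
  have : UGrp.ev w ∈ p.toHom.ker := (UGrp.ev_map _ _).symm.trans hy.1.2
  rw [h.ker_eq] at this
  obtain ⟨a, ha, e⟩ := this
  exact ⟨w, hw, rfl, a, ha, e.symm⟩

theorem mem_commutator_of_map_mem_T (h : IsExtension i p) {w : UGrp B.G}
    (hw : w ∈ ⁅B.V, (⊤ : Subgroup (UGrp B.G))⁆)
    (hT : UGrp.map p.toHom w ∈ C.T) {a : A.G} (ha : UGrp.ev w = i.toHom a) :
    a ∈ ⁅A.N, (⊤ : Subgroup A.G)⁆ := by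
  rw [← h.map_map_T] at hT
  obtain ⟨t, ht, e⟩ := hT
  obtain ⟨z, hz, hz'⟩ := h.mem_map_commutator (w := t⁻¹ * w)
    (by rw [map_mul, map_inv, e, inv_mul_cancel])
    (mul_mem (inv_mem (T_le_commutator ht)) hw)
  have : UGrp.ev z = a := by
    apply h.bijective.1
    have ht' : UGrp.ev t = 1 := (T_le_J ht).2
    rw [← UGrp.ev_map, hz', map_mul, map_inv, ht', ha, inv_one, one_mul]
  rw [← map_ev_commutator, ← this]
  exact ⟨z, hz, rfl⟩

/-- The commutators `Y` lying over `C.Z` map onto `K2 C`, and their evaluations give classes in `K1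
A`. Independence of the choice is `mem_commutator_of_map_mem_T`. -/
theorem exists_boundaryOne (h : IsExtension i p) : ∃ δ : K2 C →* K1 A, IsBoundaryOne i p δ := by
  let e := MulEquiv.ofBijective i.toHom h.bijective
  have he : ∀ y, i.toHom (e.symm y) = y := e.apply_symm_apply
  let Y : Subgroup (UGrp B.G) := ⁅B.V, (⊤ : Subgroup (UGrp B.G))⁆ ⊓ C.Z.comap (UGrp.map p.toHom)
  let q : Y →* K2 C := (K2.mk C).comp
    (((UGrp.map p.toHom).comp Y.subtype).codRestrict C.Z fun w => w.2.2)
  have hq : Function.Surjective q := by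
    intro x
    obtain ⟨y, rfl⟩ := K2.mk_surjective C x
    obtain ⟨w, hw, hw', -⟩ := h.exists_lift_Z y.2
    refine ⟨⟨w, hw, ?_⟩, ?_⟩
    · change UGrp.map p.toHom w ∈ C.Z
      rw [hw']
      exact y.2
    · change K2.mk C _ = _
      congr 1
      exact Subtype.ext hw'
  let r : Y →* K1 A := (K1.mk A).comp
    (((e.symm.toMonoidHom.comp UGrp.ev).comp Y.subtype).codRestrict A.N fun w => by
      rw [h.mem_iff]
      change p.toHom (i.toHom (e.symm (UGrp.ev (w : UGrp B.G)))) = 1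
      rw [he, ← UGrp.ev_map]
      exact w.2.2.1.2)
  have hqr : q.ker ≤ r.ker := by
    intro w hw
    have hw' : UGrp.map p.toHom (w : UGrp B.G) ∈ C.T := K2.mk_eq_one_iff.mp hw
    exact K1.mk_eq_one_iff.mpr (h.mem_commutator_of_map_mem_T w.2.1 hw' (he _).symm)
  refine ⟨q.liftOfSurjective hq ⟨r, hqr⟩, ?_⟩
  intro w a y hw hwa hwy
  have hY : w ∈ Y := ⟨hw, by
    change UGrp.map p.toHom w ∈ C.Z
    rw [hwy]
    exact y.2⟩
  have h1 : K2.mk C y = q ⟨w, hY⟩ := congrArg (K2.mk C) (Subtype.ext hwy.symm)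
  rw [h1, MonoidHom.liftOfRightInverse_comp_apply]
  exact congrArg (K1.mk A) (Subtype.ext (h.bijective.1 ((he _).trans hwa)))

/-- If `a` lies in `[N,F]`, it is the evaluation of a commutator `v` over `(N,F)`. Dividing `w` by
`v` makes its evaluation trivial without changing its image in `U_E`. -/
theorem exact_K2_boundaryOne (h : IsExtension i p) {δ : K2 C →* K1 A} (hδ : IsBoundaryOne i p δ) :
    Function.MulExact (K2.map p) δ := by
  intro x
  constructor
  · intro hx
    obtain ⟨y, rfl⟩ := K2.mk_surjective C x
    obtain ⟨w, hw, hw', a, ha, e⟩ := h.exists_lift_Z y.2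
    rw [hδ w ⟨a, ha⟩ y hw e hw', K1.mk_eq_one_iff] at hx
    change a ∈ ⁅A.N, (⊤ : Subgroup A.G)⁆ at hx
    rw [← map_ev_commutator] at hx
    obtain ⟨v, hv, rfl⟩ := hx
    have hv' : UGrp.map i.toHom v ∈ ⁅B.V, (⊤ : Subgroup (UGrp B.G))⁆ :=
      Hom.map_commutator _ i.map_V (fun _ _ => Subgroup.mem_top _) hv
    have hm : w * (UGrp.map i.toHom v)⁻¹ ∈ ⁅B.V, (⊤ : Subgroup (UGrp B.G))⁆ :=
      mul_mem hw (inv_mem hv')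
    have hR : w * (UGrp.map i.toHom v)⁻¹ ∈ B.R := by
      change UGrp.ev _ = 1
      rw [map_mul, map_inv, UGrp.ev_map, e, mul_inv_cancel]
    refine ⟨K2.mk B ⟨w * (UGrp.map i.toHom v)⁻¹, ⟨commutator_V_le hm, hR⟩, hm⟩, ?_⟩
    rw [K2.map_mk]
    congr 1
    apply Subtype.ext
    change UGrp.map p.toHom (w * (UGrp.map i.toHom v)⁻¹) = y
    rw [map_mul, map_inv, h.mem_V_iff.mp (commutator_V_le hv), inv_one, mul_one, hw']
  · rintro ⟨z, rfl⟩
    obtain ⟨z, rfl⟩ := K2.mk_surjective B z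
    rw [K2.map_mk, hδ z 1 _ z.2.2 ?_ rfl, map_one]
    rw [Subgroup.coe_one, map_one]
    exact z.2.1.2

theorem exact_boundaryOne_K1 (h : IsExtension i p) {δ : K2 C →* K1 A} (hδ : IsBoundaryOne i p δ) :
    Function.MulExact δ (K1.map i) := by
  intro x
  constructor
  · intro hx
    obtain ⟨a, rfl⟩ := K1.mk_surjective A x
    rw [K1.map_mk, K1.mk_eq_one_iff] at hx
    change i.toHom a ∈ _ at hx
    rw [← map_ev_commutator] at hx
    obtain ⟨w, hw, e⟩ := hx
    have hR : UGrp.map p.toHom w ∈ C.R := by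
      change UGrp.ev _ = 1
      rw [UGrp.ev_map, e]
      exact h.comp_eq_one _ a.2
    have hc : UGrp.map p.toHom w ∈ ⁅C.V, (⊤ : Subgroup (UGrp C.G))⁆ :=
      Hom.map_commutator _ p.map_V (fun _ _ => Subgroup.mem_top _) hw
    exact ⟨K2.mk C ⟨_, ⟨commutator_V_le hc, hR⟩, hc⟩, hδ w a _ hw e rfl⟩
  · rintro ⟨y, rfl⟩
    obtain ⟨y, rfl⟩ := K2.mk_surjective C y
    obtain ⟨w, hw, hw', a, ha, e⟩ := h.exists_lift_Z y.2
    rw [hδ w ⟨a, ha⟩ y hw e hw', K1.map_mk, K1.mk_eq_one_iff]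
    change i.toHom a ∈ _
    rw [← map_ev_commutator]
    exact ⟨w, hw, e⟩

theorem exact_K1 (h : IsExtension i p) : Function.MulExact (K1.map i) (K1.map p) := by
  intro x
  obtain ⟨m, rfl⟩ := K1.mk_surjective B x
  constructor
  · intro hx
    rw [K1.map_mk, K1.mk_eq_one_iff] at hx
    change p.toHom m ∈ _ at hx
    have : ⁅C.N, (⊤ : Subgroup C.G)⁆ = (⁅B.N, (⊤ : Subgroup B.G)⁆).map p.toHom := by
      rw [Subgroup.map_commutator, h.map_eq, Subgroup.map_top_of_surjective _ h.surjective]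
    rw [this] at hx
    obtain ⟨c, hc, e⟩ := hx
    have hk : c⁻¹ * m ∈ p.toHom.ker := by
      rw [MonoidHom.mem_ker, map_mul, map_inv, e, inv_mul_cancel]
    rw [h.ker_eq] at hk
    obtain ⟨a, ha, e'⟩ := hk
    refine ⟨K1.mk A ⟨a, ha⟩, ?_⟩
    rw [K1.map_mk, K1.mk_eq_mk_iff]
    change i.toHom a * (m : B.G)⁻¹ ∈ _
    rw [e', mul_inv_cancel_right]
    exact inv_mem hc
  · rintro ⟨a, e⟩
    obtain ⟨a, rfl⟩ := K1.mk_surjective A a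
    rw [← e, K1.map_mk, K1.map_mk, K1.mk_eq_one_iff]
    change p.toHom (i.toHom a) ∈ _
    rw [h.comp_eq_one _ a.2]
    exact one_mem _

theorem K1_map_surjective (h : IsExtension i p) : Function.Surjective (K1.map p) := by
  intro x
  obtain ⟨⟨c, hc⟩, rfl⟩ := K1.mk_surjective C x
  have hc' := hc
  rw [← h.map_eq] at hc'
  obtain ⟨m, hm, rfl⟩ := hc'
  exact ⟨K1.mk B ⟨m, hm⟩, rfl⟩

end IsExtension

/-- Boundary maps commute with morphisms of extensions. -/
theorem IsExtension.boundaryOne_natural {A' B' C' : NormalPair.{u}} {i : Hom A B} {p : Hom B C}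
    {i' : Hom A' B'} {p' : Hom B' C'} (h : IsExtension i p) {δ : K2 C →* K1 A}
    {δ' : K2 C' →* K1 A'} (hδ : IsBoundaryOne i p δ) (hδ' : IsBoundaryOne i' p' δ')
    (f : Hom A A') (g : Hom B B') (k : Hom C C')
    (hi : ∀ x, g.toHom (i.toHom x) = i'.toHom (f.toHom x))
    (hp : ∀ x, k.toHom (p.toHom x) = p'.toHom (g.toHom x)) (x : K2 C) :
    K1.map f (δ x) = δ' (K2.map k x) := by
  obtain ⟨y, rfl⟩ := K2.mk_surjective C x
  obtain ⟨w, hw, hw', a, ha, e⟩ := h.exists_lift_Z y.2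
  rw [hδ w ⟨a, ha⟩ y hw e hw', K1.map_mk, K2.map_mk]
  symm
  apply hδ' (UGrp.map g.toHom w)
  · exact Hom.map_commutator _ g.map_V (fun _ _ => Subgroup.mem_top _) hw
  · change _ = i'.toHom (f.toHom a)
    rw [UGrp.ev_map, e, hi]
  · change _ = UGrp.map k.toHom y
    rw [← hw', UGrp.map_map, UGrp.map_map]
    congr 1
    exact congrArg UGrp.map (MonoidHom.ext fun x => (hp x).symm)

end NormalPair

/-! ### Crossed modules over free-by-free groups -/

section CrossedModule

open SemidirectProduct

variable {U M X Q : Type*} [Group U] [Group M] [Group X] [Group Q]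

/-- Let `∂ : M → U` be a crossed module with central kernel on which `U` acts trivially, where `U`
is free and `U / ∂ M` is an extension of a free group `Q` by a free group `X`. Then the commutators
`n (u • n)⁻¹` generate a subgroup that meets the kernel of `∂` trivially. -/
theorem eq_one_of_crossedModule [IsFreeGroup U] [IsFreeGroup X] [IsFreeGroup Q]
    (d : M →* U) (φ : U →* MulAut M) (hd : ∀ u n, d (φ u n) = u * d n * u⁻¹)
    (hp : ∀ n m, φ (d n) m = n * m * n⁻¹) (hA : ∀ u n, d n = 1 → φ u n = n)
    (τ : X →* U) (κ : Q →* U) (V : Subgroup U) [V.Normal]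
    (hV : ∀ v, v ∈ V ↔ ∃ n x, d n * τ x = v) (hX : ∀ n x, d n * τ x = 1 → x = 1)
    (hU : ∀ u, ∃ v ∈ V, ∃ q, v * κ q = u) (hQ : ∀ q, κ q ∈ V → q = 1)
    {n : M} (hn : n ∈ Subgroup.closure {m | ∃ n u, m = n * (φ u n)⁻¹}) (hdn : d n = 1) : n = 1 := by
  -- the group extension of `V` by the kernel of `∂`
  let ψ : X →* MulAut M := φ.comp τ
  let π : M ⋊[ψ] X →* U := SemidirectProduct.lift d τ (fun x => by
    ext n
    simp only [MonoidHom.comp_apply, MulEquiv.coe_toMonoidHom, MulAut.conj_apply]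
    exact hd _ _)
  have hπ : ∀ e, π e = d e.left * τ e.right := fun e => rfl
  have hπV : ∀ e, π e ∈ V := fun e => (hV _).mpr ⟨_, _, (hπ e).symm⟩
  have hπS : ∀ v ∈ V, ∃ e, π e = v := by
    intro v hv
    obtain ⟨n, x, e⟩ := (hV v).mp hv
    exact ⟨⟨n, x⟩, e⟩
  have hπK : ∀ e, π e = 1 → ∃ a, d a = 1 ∧ e = inl a := by
    intro e he
    have hx := hX _ _ ((hπ e).symm.trans he)
    refine ⟨e.left, ?_, ?_⟩
    · rw [hπ, hx, map_one, mul_one] at he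
      exact he
    · ext <;> simp [hx]
  have hconj : ∀ e n, e * inl n * e⁻¹ = (inl (φ (π e) n) : M ⋊[ψ] X) := by
    intro e n
    have h1 : e * inl n * e⁻¹ = inl e.left * (inr e.right * inl n * inr e.right⁻¹) *
        (inl e.left : M ⋊[ψ] X)⁻¹ := by
      conv_lhs => rw [← inl_left_mul_inr_right e]
      rw [map_inv]
      group
    rw [h1, ← inl_aut, ← map_inv, ← map_mul, ← map_mul, hπ, map_mul φ, MulAut.mul_apply, hp]
    rfl
  -- the action of a free generator of `Q`
  have hα : ∀ u : U, ∃ α : MulAut (M ⋊[ψ] X), (∀ n, α (inl n) = inl (φ u n)) ∧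
      ∀ e, π (α e) = u * π e * u⁻¹ := by
    intro u
    -- As `X` is free, the conjugates `u * τ x * u⁻¹` lift multiplicatively along `π`. Together with
    -- `φ u` on `M`, this defines an endomorphism covering conjugation by `u`.
    obtain ⟨l, hl⟩ := IsFreeGroup.exists_lift π ((MulAut.conj u).toMonoidHom.comp τ) (fun x => by
      apply hπS
      exact (inferInstance : V.Normal).conj_mem _
        ((hV _).mpr ⟨1, x, by rw [map_one, one_mul]⟩) _)
    replace hl : ∀ x, π (l x) = u * τ x * u⁻¹ := hl
    let a : M ⋊[ψ] X →* M ⋊[ψ] X :=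
      SemidirectProduct.lift (inl.comp (φ u).toMonoidHom) l (fun x => by
        ext n : 1
        simp only [MonoidHom.comp_apply, MulEquiv.coe_toMonoidHom, MulAut.conj_apply]
        rw [hconj, hl]
        change inl (φ u (φ (τ x) n)) = _
        rw [← MulAut.mul_apply, ← map_mul, ← MulAut.mul_apply, ← map_mul, inv_mul_cancel_right])
    have ha : ∀ n, a (inl n) = inl (φ u n) := fun n => lift_inl _ _ _ n
    have haπ : ∀ e, π (a e) = u * π e * u⁻¹ := by
      intro e
      have h1 : a e = inl (φ u e.left) * l e.right := rfl
      have h2 : π (inl (φ u e.left)) = d (φ u e.left) := lift_inl _ _ _ _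
      rw [h1, map_mul, h2, hl, hd, hπ]
      group
    -- The endomorphism induces conjugation by `u` on `V` and the identity on the kernel of `π`,
    -- hence is bijective.
    have hai : Function.Injective a := by
      rw [injective_iff_map_eq_one]
      intro e he
      have h1 := haπ e
      rw [he, map_one, eq_comm, mul_inv_eq_one, mul_eq_left] at h1
      obtain ⟨b, hb, rfl⟩ := hπK e h1
      rw [ha, hA _ _ hb] at he
      exact he
    have has : Function.Surjective a := by
      intro e
      obtain ⟨e', he'⟩ := hπS (u⁻¹ * π e * u) (by
        simpa using (inferInstance : V.Normal).conj_mem _ (hπV e) u⁻¹)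
      obtain ⟨b, hb, hb'⟩ := hπK ((a e')⁻¹ * e) (by
        rw [map_mul, map_inv, haπ, he']
        group)
      refine ⟨e' * inl b, ?_⟩
      rw [map_mul, ha, hA _ _ hb, ← hb', mul_inv_cancel_left]
    exact ⟨MulEquiv.ofBijective a ⟨hai, has⟩, ha, haπ⟩
  choose α hα₁ hα₂ using hα
  -- The automorphisms `α` need not be multiplicative in `u`, so they are used only on free
  -- generators of `Q`. The subgroup `S` propagates their two properties to all of `Q`.
  let θ : Q →* MulAut (M ⋊[ψ] X) := IsFreeGroup.lift fun y => α (κ (IsFreeGroup.of y))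
  let S : Subgroup Q :=
    { carrier := {q | (∀ n, θ q (inl n) = inl (φ (κ q) n)) ∧
        ∀ e, π (θ q e) = κ q * π e * (κ q)⁻¹}
      one_mem' := ⟨fun n => by simp, fun e => by simp⟩
      mul_mem' := by
        rintro p q ⟨hp₁, hp₂⟩ ⟨hq₁, hq₂⟩
        refine ⟨fun n => ?_, fun e => ?_⟩
        · rw [map_mul, MulAut.mul_apply, hq₁, hp₁, map_mul, map_mul, MulAut.mul_apply]
        · rw [map_mul, MulAut.mul_apply, hp₂, hq₂, map_mul]
          group
      inv_mem' := by
        rintro p ⟨hp₁, hp₂⟩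
        refine ⟨fun n => ?_, fun e => ?_⟩
        · apply (θ p).injective
          rw [hp₁, map_inv, MulAut.apply_inv_self, map_inv, map_inv, MulAut.apply_inv_self]
        · have := hp₂ (θ p⁻¹ e)
          rw [map_inv, MulAut.apply_inv_self] at this
          rw [map_inv, map_inv, this]
          group }
  have hS : ∀ q, q ∈ S := by
    intro q
    have : S.subtype.comp (IsFreeGroup.lift fun y => (⟨IsFreeGroup.of y, by
        refine ⟨fun n => ?_, fun e => ?_⟩
        · simp only [θ, IsFreeGroup.lift_of, hα₁]
        · simp only [θ, IsFreeGroup.lift_of, hα₂]⟩ : S)) = MonoidHom.id Q := by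
      apply IsFreeGroup.ext_hom
      intro y
      simp
    rw [← MonoidHom.id_apply Q q, ← this]
    exact SetLike.coe_mem _
  -- the group extension of `U` by the kernel of `∂`
  let ϖ : (M ⋊[ψ] X) ⋊[θ] Q →* U := SemidirectProduct.lift π κ (fun q => by
    ext e : 1
    simp only [MonoidHom.comp_apply, MulEquiv.coe_toMonoidHom, MulAut.conj_apply]
    exact (hS q).2 e)
  have hϖ : ∀ e, ϖ e = π e.left * κ e.right := fun e => rfl
  let j : M →* (M ⋊[ψ] X) ⋊[θ] Q := inl.comp inl
  have hj : Function.Injective j := inl_injective.comp inl_injective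
  have hϖj : ∀ n, ϖ (j n) = d n := fun n => by
    change ϖ (inl (inl n)) = d n
    rw [lift_inl, lift_inl]
  have hjconj : ∀ e n, e * j n * e⁻¹ = j (φ (ϖ e) n) := by
    intro e n
    have h1 : e * j n * e⁻¹ = inl e.left * (inr e.right * inl (inl n) * inr e.right⁻¹) *
        (inl e.left : (M ⋊[ψ] X) ⋊[θ] Q)⁻¹ := by
      conv_lhs => rw [← inl_left_mul_inr_right e]
      rw [map_inv]
      change _ * inl (inl n) * _ = _
      group
    rw [h1, ← inl_aut, ← map_inv, ← map_mul, ← map_mul, (hS _).1, hconj, hϖ, map_mul φ,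
      MulAut.mul_apply]
    rfl
  have hϖK : ∀ e, ϖ e = 1 → ∃ a, d a = 1 ∧ e = j a := by
    intro e he
    have h1 := (hϖ e).symm.trans he
    have hq : e.right = 1 := by
      apply hQ
      rw [eq_inv_of_mul_eq_one_right h1]
      exact inv_mem (hπV _)
    rw [hq, map_one, mul_one] at h1
    obtain ⟨a, ha, h2⟩ := hπK _ h1
    refine ⟨a, ha, ?_⟩
    rw [← inl_left_mul_inr_right e, hq, map_one, mul_one, h2]
    rfl
  -- `ϖ` is onto the free group `U` and splits. Then `j n` and `σ (d n)` differ by a central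
  -- element, so `j` and `σ ∘ d` agree on all `n * (u • n)⁻¹`.
  obtain ⟨σ, hσ⟩ := IsFreeGroup.exists_lift ϖ (MonoidHom.id U) (fun u => by
    obtain ⟨v, hv, q, rfl⟩ := hU u
    obtain ⟨e, rfl⟩ := hπS v hv
    exact ⟨⟨e, q⟩, rfl⟩)
  replace hσ : ∀ u, ϖ (σ u) = u := hσ
  have key : Subgroup.closure {m | ∃ n u, m = n * (φ u n)⁻¹} ≤ j.eqLocus (σ.comp d) := by
    rw [Subgroup.closure_le]
    rintro _ ⟨m, u, rfl⟩
    change j _ = σ (d _)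
    obtain ⟨a, ha, hja⟩ := hϖK (j m * (σ (d m))⁻¹) (by
      rw [map_mul, map_inv, hσ, hϖj, mul_inv_cancel])
    have hjm : j m = j a * σ (d m) := by rw [← hja, inv_mul_cancel_right]
    have hac : ∀ e, Commute (j a) e := by
      intro e
      have := hjconj e a
      rw [hA _ _ ha, mul_inv_eq_iff_eq_mul] at this
      exact this.symm
    have h1 : j (m * (φ u m)⁻¹) = ⁅j m, σ u⁆ := by
      have := hjconj (σ u) m
      rw [hσ] at this
      rw [map_mul, map_inv, ← this, commutatorElement_def]
      group
    have h2 : σ (d (m * (φ u m)⁻¹)) = ⁅σ (d m), σ u⁆ := by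
      rw [map_mul, map_inv, hd, ← map_commutatorElement, commutatorElement_def]
      congr 1
      group
    rw [h1, h2, hjm]
    have := commutatorElement_mul_mul_of_commute (x := σ (d m)) (y := σ u) hac
      (Commute.one_left _) (Commute.one_left _)
    rwa [one_mul] at this
  apply hj
  have : j n = σ (d n) := key hn
  rw [this, hdn, map_one, map_one]

end CrossedModule

namespace NormalPair

variable {A B C D : NormalPair.{u}}

/-! ### Vanishing results and presentations by free groups -/

instance (A : NormalPair.{u}) : IsFreeGroup (susp A).G := inferInstanceAs (IsFreeGroup (UGrp A.G))

theorem mk_J_commute {j : UGrp A.G} (hj : j ∈ A.J) (g : UGrp A.G ⧸ A.T) :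
    Commute (QuotientGroup.mk' A.T j) g := by
  obtain ⟨g, rfl⟩ := QuotientGroup.mk'_surjective _ g
  exact Subgroup.mk_commute_of_commutator_le J_commutator_le_T hj (Subgroup.mem_top _)

theorem mk_R_commute {r v : UGrp A.G} (hr : r ∈ A.R) (hv : v ∈ A.V) :
    Commute (QuotientGroup.mk' A.T r) (QuotientGroup.mk' A.T v) :=
  (Subgroup.mk_commute_of_commutator_le V_commutator_R_le_T hv hr).symm

/-- Modulo `T`, `J` is central and `R` commutes with `V`. Replacing each `w` by `σ (ev w)` thus
leaves commutators of `V` with `U_F` unchanged, while it sends elements of `J` to `1`. -/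
theorem K2.eq_one_of_section (σ : A.G →* UGrp A.G) (hσ : ∀ x, UGrp.ev (σ x) = x)
    (hN : ∀ x ∈ A.N, σ x ∈ A.V) (x : A.K2) : x = 1 := by
  obtain ⟨z, rfl⟩ := K2.mk_surjective A x
  have hr : ∀ w, w * (σ (UGrp.ev w))⁻¹ ∈ A.R := fun w => by
    change UGrp.ev _ = 1
    rw [map_mul, map_inv, hσ, mul_inv_cancel]
  have e : ∀ w, QuotientGroup.mk' A.T w = QuotientGroup.mk' A.T (w * (σ (UGrp.ev w))⁻¹) *
      QuotientGroup.mk' A.T (σ (UGrp.ev w)) := fun w => by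
    rw [← map_mul, inv_mul_cancel_right]
  have := (QuotientGroup.mk' A.T).eq_of_mem_commutator
    ((QuotientGroup.mk' A.T).comp (σ.comp UGrp.ev)) (fun v hv w _ => by
      have hv' := hN _ (ev_mem_of_mem_V hv)
      rw [e v, e w]
      refine commutatorElement_mul_mul_of_commute
        (mk_J_commute ⟨A.V.mul_mem hv (A.V.inv_mem hv'), hr v⟩) (mk_R_commute (hr w) hv') ?_
      rw [← map_commutatorElement]
      exact mk_R_commute (hr w) (commutator_V_le
        (Subgroup.commutator_mem_commutator hv' (Subgroup.mem_top _)))) z.2.2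
  rw [K2.mk_eq_one_iff, ← QuotientGroup.eq_one_iff]
  refine this.trans ?_
  have hz : UGrp.ev (z : UGrp A.G) = 1 := z.2.1.2
  simp [hz]

/-- A section of evaluation that maps `N` into `V` is needed. It is obtained by prescribing its
image in `U_E` as `τ ∘ p`, with `τ` a splitting of `U_E → E`: this image is trivial on `N`. -/
theorem K2.eq_one_of_free [IsFreeGroup A.G] {E : Type u} [Group E] [IsFreeGroup E]
    (p : A.G →* E) (hp : Function.Surjective p) (hN : p.ker = A.N) (x : A.K2) : x = 1 := by
  obtain ⟨τ, hτ⟩ := IsFreeGroup.exists_lift (UGrp.ev (F := E)) (MonoidHom.id E)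
    UGrp.ev_surjective
  obtain ⟨σ, hσ⟩ := IsFreeGroup.exists_lift ((UGrp.ev (F := A.G)).prod (UGrp.map p))
    ((MonoidHom.id A.G).prod (τ.comp p)) (fun x => by
      obtain ⟨w, hw⟩ := UGrp.map_surjective hp (τ (p x))
      have : (UGrp.ev w)⁻¹ * x ∈ p.ker := by
        have h1 : UGrp.ev (τ (p x)) = p x := hτ _
        rw [MonoidHom.mem_ker, map_mul, map_inv, ← UGrp.ev_map, hw, h1, inv_mul_cancel]
      refine ⟨w * UGrp.u ((UGrp.ev w)⁻¹ * x), Prod.ext ?_ ?_⟩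
      · change UGrp.ev (w * UGrp.u ((UGrp.ev w)⁻¹ * x)) = x
        rw [map_mul, UGrp.ev_u, mul_inv_cancel_left]
      · change UGrp.map p (w * UGrp.u ((UGrp.ev w)⁻¹ * x)) = τ (p x)
        rw [map_mul, UGrp.map_u, MonoidHom.mem_ker.mp this, UGrp.u_one, mul_one, hw])
  refine K2.eq_one_of_section σ (fun x => congrArg Prod.fst (hσ x)) (fun x hx => ?_) x
  have h1 : UGrp.map p (σ x) = τ (p x) := congrArg Prod.snd (hσ x)
  rw [← hN] at hx
  rw [MonoidHom.mem_ker.mp hx, map_one] at h1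
  refine (UGrp.map_eq_one_iff_of_ker_eq ?_ _).mp h1
  rw [QuotientGroup.ker_mk', hN]

/-- `K2` only depends on the quotient when the ambient group is free. -/
theorem K2.map_bijective_of_free [IsFreeGroup B.G] [IsFreeGroup C.G] (p : Hom B C)
    (hp : Function.Surjective p.toHom) (hN : ∀ x, p.toHom x ∈ C.N → x ∈ B.N) :
    Function.Bijective (K2.map p) := by
  -- In the sequence of the extension by `ker p`, the kernel pair has trivial `K2` since both
  -- ambient groups are free, and the boundary to its `K1` vanishes since `p` splits.
  let A : NormalPair.{u} := ⟨B.G, p.toHom.ker⟩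
  let i : Hom A B := ⟨MonoidHom.id B.G, fun x hx => hN x (by
    rw [MonoidHom.mem_ker.mp hx]
    exact one_mem _)⟩
  have h : IsExtension i p :=
    { bijective := Function.bijective_id
      surjective := hp
      ker_eq := (Subgroup.map_id _).symm
      map_eq := by
        apply le_antisymm (Subgroup.map_le_iff_le_comap.mpr p.mem)
        intro y hy
        obtain ⟨x, rfl⟩ := hp y
        exact ⟨x, hN x hy, rfl⟩ }
  obtain ⟨δ, hδ⟩ := h.exists_boundaryOne
  constructor
  · rw [injective_iff_map_eq_one]
    intro x hx
    obtain ⟨y, rfl⟩ := (h.exact_K2 x).mp hx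
    have : IsFreeGroup A.G := inferInstanceAs (IsFreeGroup B.G)
    rw [K2.eq_one_of_free (A := A) p.toHom hp rfl y, map_one]
  · intro x
    refine (h.exact_K2_boundaryOne hδ x).mp ?_
    have h1 : K1.map i (δ x) = 1 := (h.exact_boundaryOne_K1 hδ _).mpr ⟨x, rfl⟩
    obtain ⟨a, ha⟩ := K1.mk_surjective A (δ x)
    rw [← ha] at h1 ⊢
    rw [K1.map_mk, K1.mk_eq_one_iff] at h1
    rw [K1.mk_eq_one_iff]
    obtain ⟨s, hs⟩ := IsFreeGroup.exists_lift p.toHom (MonoidHom.id _) hp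
    exact MonoidHom.ker_inf_commutator_le p.toHom s hs
      ⟨a.2, Subgroup.commutator_mono le_top le_rfl h1⟩

/-- The image `M` of `U_{N,F}` modulo `T` is a crossed module over `F`: `[U_{N,F}, J_F]` makes the
action of `U_F` descend to `F`, and `[J_{N,F}, U_F]` makes the kernel central with trivial action.
`K2` is the part of this kernel inside the commutator subgroup. -/
theorem K2.eq_one_of_free_by_free [IsFreeGroup A.G] {X Q : Type u} [Group X] [Group Q]
    [IsFreeGroup X] [IsFreeGroup Q] (τ : X →* A.G) (κ : Q →* A.G) (V : Subgroup A.G) [V.Normal]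
    (hV : ∀ v, v ∈ V ↔ ∃ n ∈ A.N, ∃ x, n * τ x = v) (hX : ∀ x, τ x ∈ A.N → x = 1)
    (hU : ∀ u, ∃ v ∈ V, ∃ q, v * κ q = u) (hQ : ∀ q, κ q ∈ V → q = 1) (x : A.K2) : x = 1 := by
  obtain ⟨z, rfl⟩ := K2.mk_surjective A x
  obtain ⟨σ, hσ⟩ := IsFreeGroup.exists_lift (UGrp.ev (F := A.G)) (MonoidHom.id _)
    UGrp.ev_surjective
  replace hσ : ∀ x, UGrp.ev (σ x) = x := hσ
  let W := UGrp A.G ⧸ A.T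
  let mk : UGrp A.G →* W := QuotientGroup.mk' A.T
  let M : Subgroup W := A.V.map mk
  have hM : M.Normal := Subgroup.Normal.map inferInstance _ (QuotientGroup.mk'_surjective _)
  let e : W →* A.G := QuotientGroup.lift A.T UGrp.ev fun w hw => (T_le_J hw).2
  have he : ∀ w, e (mk w) = UGrp.ev w := fun w => rfl
  let d : M →* A.G := e.comp M.subtype
  let φ : A.G →* MulAut M := (MulAut.conjNormal (H := M)).comp (mk.comp σ)
  have hφ : ∀ g (n : M), ((φ g n : M) : W) = mk (σ g) * n * (mk (σ g))⁻¹ := fun g n =>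
    MulAut.conjNormal_apply _ _
  have hσr : ∀ w : UGrp A.G, ∃ r ∈ A.R, σ (UGrp.ev w) = r * w := fun w =>
    ⟨σ (UGrp.ev w) * w⁻¹, by
      change UGrp.ev _ = 1
      rw [map_mul, map_inv, hσ, mul_inv_cancel], by rw [inv_mul_cancel_right]⟩
  have hconj : ∀ w v, v ∈ A.V →
      mk (σ (UGrp.ev w)) * mk v * (mk (σ (UGrp.ev w)))⁻¹ = mk w * mk v * (mk w)⁻¹ := by
    intro w v hv
    obtain ⟨r, hr, e1⟩ := hσr w
    have h1 : mk w * mk v * (mk w)⁻¹ = mk (w * v * w⁻¹) := by simp only [map_mul, map_inv]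
    have h2 : Commute (mk r) (mk w * mk v * (mk w)⁻¹) := by
      rw [h1]
      exact mk_R_commute hr ((inferInstance : A.V.Normal).conj_mem v hv w)
    rw [e1, map_mul, mul_inv_rev]
    calc mk r * mk w * mk v * ((mk w)⁻¹ * (mk r)⁻¹)
        = (mk r * (mk w * mk v * (mk w)⁻¹)) * (mk r)⁻¹ := by group
      _ = _ := by rw [h2.eq, mul_inv_cancel_right]
  have hdN : ∀ n, d n ∈ A.N := by
    rintro ⟨_, v, hv, rfl⟩
    exact ev_mem_of_mem_V hv
  have hNd : ∀ a ∈ A.N, ∃ n, d n = a := fun a ha =>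
    ⟨⟨mk (UGrp.u a), UGrp.u a, u_mem_V ha, rfl⟩, UGrp.ev_u a⟩
  let n : M := ⟨mk z, z, z.2.1.1, rfl⟩
  have hn : n ∈ Subgroup.closure {m | ∃ n u, m = n * (φ u n)⁻¹} := by
    have key : ⁅A.V, (⊤ : Subgroup (UGrp A.G))⁆ ≤
        ((Subgroup.closure {m | ∃ n u, m = n * (φ u n)⁻¹}).map M.subtype).comap mk := by
      rw [Subgroup.commutator_le]
      intro v hv w _
      let m : M := ⟨mk v, v, hv, rfl⟩
      refine ⟨m * (φ (UGrp.ev w) m)⁻¹, Subgroup.subset_closure ⟨m, _, rfl⟩, ?_⟩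
      change mk v * ((φ (UGrp.ev w) m : M) : W)⁻¹ = mk ⁅v, w⁆
      rw [hφ, hconj w v hv, map_commutatorElement, commutatorElement_def]
      group
    obtain ⟨m, hm, hmn⟩ := key z.2.2
    have : m = n := Subtype.ext hmn
    rwa [← this]
  have := eq_one_of_crossedModule d φ ?_ ?_ ?_ τ κ V ?_ ?_ hU hQ hn z.2.1.2
  · rw [K2.mk_eq_one_iff, ← QuotientGroup.eq_one_iff]
    exact congrArg Subtype.val this
  · intro g n
    change e (φ g n : M) = g * e n * g⁻¹
    rw [hφ, map_mul, map_mul, map_inv, he, hσ]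
  · rintro ⟨_, v, hv, rfl⟩ ⟨_, v', hv', rfl⟩
    apply Subtype.ext
    rw [hφ]
    exact hconj v v' hv'
  · rintro g ⟨_, v, hv, rfl⟩ h1
    apply Subtype.ext
    rw [hφ]
    change mk (σ g) * mk v * (mk (σ g))⁻¹ = mk v
    rw [← (mk_J_commute ⟨hv, h1⟩ (mk (σ g))).eq, mul_inv_cancel_right]
  · intro v
    rw [hV]
    constructor
    · rintro ⟨a, ha, x, rfl⟩
      obtain ⟨n, rfl⟩ := hNd a ha
      exact ⟨n, x, rfl⟩
    · rintro ⟨n, x, rfl⟩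
      exact ⟨d n, hdN n, x, rfl⟩
  · intro n x h1
    apply hX
    rw [eq_inv_of_mul_eq_one_right h1]
    exact inv_mem (hdN n)

/-- The group `K^J_3(N,F)` is trivial if `N` is free. -/
theorem K2.susp_eq_one (A : NormalPair.{u}) [IsFreeGroup A.N] (x : (susp A).K2) : x = 1 := by
  -- The quotient `U_F / J_{N,F}` is an extension of the free group `U_{F/N}` by `U_{N,F} / J_{N,F}
  -- ≅ N`, so the criterion applies with `X = N` and `Q = U_{F/N}`.
  obtain ⟨τ, hτ⟩ := IsFreeGroup.exists_lift
    (((UGrp.ev (F := A.G)).comp A.V.subtype).codRestrict A.N fun v => ev_mem_of_mem_V v.2)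
    (MonoidHom.id A.N) (fun x => ⟨⟨UGrp.u x, u_mem_V x.2⟩, Subtype.ext (UGrp.ev_u _)⟩)
  replace hτ : ∀ x, UGrp.ev (τ x : UGrp A.G) = x := fun x => congrArg Subtype.val (hτ x)
  obtain ⟨κ, hκ⟩ := IsFreeGroup.exists_lift (UGrp.map (QuotientGroup.mk' A.N)) (MonoidHom.id _)
    (UGrp.map_surjective (QuotientGroup.mk'_surjective _))
  replace hκ : ∀ q, UGrp.map (QuotientGroup.mk' A.N) (κ q) = q := hκ
  let V : Subgroup (susp A).G := A.V
  have hV : V.Normal := inferInstanceAs A.V.Normal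
  refine K2.eq_one_of_free_by_free (A := susp A) (A.V.subtype.comp τ) κ V ?_ ?_ ?_ ?_ x
  · intro (v : UGrp A.G)
    constructor
    · intro hv
      refine ⟨v * (τ ⟨UGrp.ev v, ev_mem_of_mem_V hv⟩ : UGrp A.G)⁻¹,
        ⟨A.V.mul_mem hv (A.V.inv_mem (SetLike.coe_mem _)), ?_⟩, ⟨UGrp.ev v, ev_mem_of_mem_V hv⟩,
        inv_mul_cancel_right _ _⟩
      change UGrp.ev (_ * _) = 1
      rw [map_mul, map_inv, hτ, mul_inv_cancel]
    · rintro ⟨n, hn, x, rfl⟩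
      exact mul_mem hn.1 (τ x).2
  · intro x hx
    have h1 : UGrp.ev (τ x : UGrp A.G) = 1 := hx.2
    rw [hτ] at h1
    exact Subtype.ext h1
  · intro (w : UGrp A.G)
    refine ⟨w * (κ (UGrp.map (QuotientGroup.mk' A.N) w))⁻¹, ?_,
      UGrp.map (QuotientGroup.mk' A.N) w, inv_mul_cancel_right _ _⟩
    change UGrp.map (QuotientGroup.mk' A.N) _ = 1
    rw [map_mul, map_inv, hκ, mul_inv_cancel]
  · intro q hq
    have h1 : UGrp.map (QuotientGroup.mk' A.N) (κ q) = 1 := hq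
    rwa [hκ] at h1

end NormalPair

namespace NormalPair

variable {A B C D : NormalPair.{u}}

/-! ### Pairs over the free cover -/

/-- The pair `(J_F, U_F)`; its `K2` is the third homology of `F`. -/
noncomputable def rel (A : NormalPair.{u}) : NormalPair.{u} := ⟨UGrp A.G, A.R⟩

/-- The pair of `U_F` and the preimage of `N`; its `K2` is the third homology of `F / N`. -/
noncomputable def pull (A : NormalPair.{u}) : NormalPair.{u} := ⟨UGrp A.G, A.N.comap UGrp.ev⟩

instance (A : NormalPair.{u}) : IsFreeGroup (rel A).G := inferInstanceAs (IsFreeGroup (UGrp A.G))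
instance (A : NormalPair.{u}) : IsFreeGroup (pull A).G := inferInstanceAs (IsFreeGroup (UGrp A.G))

/-- The inclusion `(J_{N,F}, U_F) ⊆ (J_F, U_F)`. -/
noncomputable def suspToRel (A : NormalPair.{u}) : Hom (susp A) (rel A) :=
  ⟨MonoidHom.id (UGrp A.G), fun _ hx => hx.2⟩

/-- The inclusion of `(J_F, U_F)` into the preimage of `(N,F)`. -/
noncomputable def relToPull (A : NormalPair.{u}) : Hom (rel A) (pull A) :=
  ⟨MonoidHom.id (UGrp A.G), fun x hx => by
    have : UGrp.ev (show UGrp A.G from x) = 1 := hx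
    change UGrp.ev (show UGrp A.G from x) ∈ A.N
    rw [this]
    exact one_mem _⟩

/-- The inclusion of `(J_{N,F}, U_F)` into the preimage of `(N,F)`. -/
noncomputable def suspToPull (A : NormalPair.{u}) : Hom (susp A) (pull A) :=
  (relToPull A).comp (suspToRel A)

/-- The evaluation from the preimage of `(N,F)` to `(N,F)`. -/
noncomputable def pullEv (A : NormalPair.{u}) : Hom (pull A) A := ⟨UGrp.ev, fun _ hx => hx⟩

/-- The morphism `(J_F, U_F) → (J_G, U_G)` induced by a morphism of pairs. -/
noncomputable def Hom.rel (f : Hom A B) : Hom (NormalPair.rel A) (NormalPair.rel B) :=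
  ⟨UGrp.map f.toHom, f.map_R⟩

/-- The morphism of preimages in the free covers induced by a morphism of pairs. -/
noncomputable def Hom.pull (f : Hom A B) : Hom (NormalPair.pull A) (NormalPair.pull B) :=
  ⟨UGrp.map f.toHom, fun (w : UGrp A.G) hw => by
    change UGrp.ev (UGrp.map f.toHom w) ∈ B.N
    rw [UGrp.ev_map]
    exact f.mem _ hw⟩

theorem isExtension_pullEv (A : NormalPair.{u}) : IsExtension (relToPull A) (pullEv A) where
  bijective := Function.bijective_id
  surjective := UGrp.ev_surjective
  ker_eq := (Subgroup.map_id (G := UGrp A.G) A.R).symm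
  map_eq := Subgroup.map_comap_eq_self_of_surjective UGrp.ev_surjective _

/-- The map factors through `(U_{N,F}, U_F)`, whose quotient `U_{F/N}` is free, so that its `K2` is
trivial. -/
theorem K2.map_suspToPull (x : (susp A).K2) : K2.map (suspToPull A) x = 1 := by
  let W : NormalPair.{u} := ⟨UGrp A.G, A.V⟩
  have : IsFreeGroup W.G := inferInstanceAs (IsFreeGroup (UGrp A.G))
  let f : Hom (susp A) W := ⟨MonoidHom.id (UGrp A.G), fun _ hx => hx.1⟩
  let g : Hom W (pull A) := ⟨MonoidHom.id (UGrp A.G), fun _ hx => ev_mem_of_mem_V hx⟩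
  rw [← K2.map_map_eq_map (f := f) (g := g) (fun _ => rfl),
    K2.eq_one_of_free (A := W) (UGrp.map (QuotientGroup.mk' A.N))
      (UGrp.map_surjective (QuotientGroup.mk'_surjective _)) rfl (K2.map f x), map_one]

theorem K2.map_relToPull_suspToRel (x : (susp A).K2) :
    K2.map (relToPull A) (K2.map (suspToRel A) x) = 1 := by
  rw [K2.map_map_eq_map (k := suspToPull A) (fun _ => rfl), K2.map_suspToPull]

theorem Hom.map_suspToRel (f : Hom A B) (x : (NormalPair.susp A).K2) :
    K2.map (suspToRel B) (K2.map f.susp x) = K2.map f.rel (K2.map (suspToRel A) x) := by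
  refine K2.map_map_eq (fun _ => ?_) x
  rfl

theorem Hom.map_relToPull (f : Hom A B) (x : (NormalPair.rel A).K2) :
    K2.map (relToPull B) (K2.map f.rel x) = K2.map f.pull (K2.map (relToPull A) x) := by
  refine K2.map_map_eq (fun _ => ?_) x
  rfl

theorem Hom.map_pullEv (f : Hom A B) (x : (NormalPair.pull A).K2) :
    K2.map (pullEv B) (K2.map f.pull x) = K2.map f (K2.map (pullEv A) x) :=
  K2.map_map_eq (UGrp.ev_map f.toHom) x

theorem Hom.bijective_rel (f : Hom A B) (hf : Function.Bijective f.toHom) :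
    Function.Bijective (K2.map f.rel) := by
  refine K2.map_bijective_of_free f.rel (UGrp.map_surjective hf.2) fun (w : UGrp A.G) hw => ?_
  apply hf.1
  rw [← UGrp.ev_map, map_one]
  exact hw

namespace IsExtension

variable {i : Hom A B} {p : Hom B C}

theorem bijective_pull (h : IsExtension i p) : Function.Bijective (K2.map p.pull) := by
  refine K2.map_bijective_of_free p.pull (UGrp.map_surjective h.surjective)
    fun (w : UGrp B.G) hw => h.mem_of_apply_mem ?_
  rw [← UGrp.ev_map]
  exact hw

/-- The morphism from the preimage of `(N,F)` to `(J_E, U_E)`, where `E = F / N`. -/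
noncomputable def pullToRel (h : IsExtension i p) : Hom (pull A) (rel C) :=
  ⟨(UGrp.map p.toHom).comp (UGrp.map i.toHom), fun (w : UGrp A.G) hw => by
    change UGrp.ev (UGrp.map p.toHom (UGrp.map i.toHom w)) = 1
    rw [UGrp.ev_map, UGrp.ev_map]
    exact h.comp_eq_one _ hw⟩

theorem map_pullToRel_relToPull (h : IsExtension i p) (x : (rel A).K2) :
    K2.map h.pullToRel (K2.map (relToPull A) x) = K2.map p.rel (K2.map i.rel x) := by
  refine K2.map_map_eq (fun _ => ?_) x
  rfl

theorem map_relToPull_pullToRel (h : IsExtension i p) (x : (pull A).K2) :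
    K2.map (relToPull C) (K2.map h.pullToRel x) = K2.map p.pull (K2.map i.pull x) := by
  refine K2.map_map_eq (fun _ => ?_) x
  rfl

/-- Both pairs have free ambient groups and the same quotient `E = F / N`. -/
theorem bijective_pullToRel (h : IsExtension i p) : Function.Bijective (K2.map h.pullToRel) := by
  refine K2.map_bijective_of_free h.pullToRel ((UGrp.map_surjective h.surjective).comp
    (UGrp.map_surjective h.bijective.2)) fun (w : UGrp A.G) hw => h.mem_iff.mpr ?_
  rw [← UGrp.ev_map, ← UGrp.ev_map]
  exact hw

/-- The boundary map `K^J_3(P,E) → K^J_2(N,F)`. -/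
noncomputable def boundary (h : IsExtension i p) : K2 (susp C) →* K2 A :=
  (K2.map (pullEv A)).comp ((MulEquiv.ofBijective _ h.bijective_pullToRel).symm.toMonoidHom.comp
    (K2.map (suspToRel C)))

theorem boundary_eq (h : IsExtension i p) {x : K2 (susp C)} {y : K2 (pull A)}
    (e : K2.map h.pullToRel y = K2.map (suspToRel C) x) : h.boundary x = K2.map (pullEv A) y := by
  change K2.map (pullEv A) ((MulEquiv.ofBijective _ h.bijective_pullToRel).symm
    (K2.map (suspToRel C) x)) = _
  rw [← e]
  congr 1
  exact (MulEquiv.ofBijective _ h.bijective_pullToRel).symm_apply_apply y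

/-- As `i` identifies the ambient groups, the free coordinate of the cone gives a morphism to `pull
A`. Its evaluation is the projection to `A`, and its image in `rel C` is the one of `coneToSusp`. -/
theorem boundary_cone (h : IsExtension i p) (x : K2 (cone i)) :
    h.boundary (K2.map (coneToSusp i p h.comp_eq_one) x) = K2.map (coneFst i) x := by
  let e := MulEquiv.ofBijective i.toHom h.bijective
  have he : ∀ a, e.symm.toMonoidHom (i.toHom a) = a := e.symm_apply_apply
  have he' : i.toHom.comp e.symm.toMonoidHom = MonoidHom.id B.G :=
    MonoidHom.ext e.apply_symm_apply
  let g : (cone i).G →* UGrp A.G := (UGrp.map e.symm.toMonoidHom).comp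
    ((MonoidHom.snd A.G (UGrp B.G)).comp (coneGroup i).subtype)
  have hg : ∀ c : coneGroup i, UGrp.ev (g c) = c.1.1 := by
    intro c
    have hc : i.toHom c.1.1 = UGrp.ev c.1.2 := c.2
    change UGrp.ev (UGrp.map _ c.1.2) = _
    rw [UGrp.ev_map, ← hc, he]
  let f : Hom (cone i) (pull A) := ⟨g, fun (c : coneGroup i) hc => by
    change UGrp.ev (g c) ∈ A.N
    rw [hg]
    exact hc.1⟩
  rw [h.boundary_eq (y := K2.map f x), K2.map_map_eq_map]
  · exact hg
  · refine K2.map_map_eq (fun c => ?_) x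
    change UGrp.map p.toHom (UGrp.map i.toHom (UGrp.map e.symm.toMonoidHom c.1.2)) =
      UGrp.map p.toHom c.1.2
    rw [UGrp.map_map i.toHom, he', UGrp.map_id]
    rfl

/-! ### Exactness under conditions of first and second order -/

theorem boundary_map (h : IsExtension i p) (z : K2 (susp B)) :
    h.boundary (K2.map p.susp z) = 1 := by
  obtain ⟨y, hy⟩ := (i.bijective_rel h.bijective).2 (K2.map (suspToRel B) z)
  rw [h.boundary_eq (y := K2.map (relToPull A) y)]
  · exact ((isExtension_pullEv A).exact_K2 _).mpr ⟨y, rfl⟩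
  · rw [h.map_pullToRel_relToPull, hy, p.map_suspToRel]

theorem map_boundary (h : IsExtension i p) (t : K2 (susp C)) : K2.map i (h.boundary t) = 1 := by
  obtain ⟨y, hy⟩ := h.bijective_pullToRel.2 (K2.map (suspToRel C) t)
  rw [h.boundary_eq hy, ← i.map_pullEv]
  have : K2.map i.pull y = 1 := by
    apply h.bijective_pull.1
    rw [map_one, ← h.map_relToPull_pullToRel, hy, K2.map_relToPull_suspToRel]
  rw [this, map_one]

/-- The obstruction to lifting `x` to `K2 (pull A)` lies in `K1 (rel A)`, which `i` identifies with
`K1 (rel B)`; there it vanishes. A correction from `K2 (rel A)` makes the image in `K2 (pull C)`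
trivial, and `hC` then produces the preimage. -/
theorem exact_boundary_of_forall (h : IsExtension i p)
    (hC : ∀ x : K2 (rel C), K2.map (relToPull C) x = 1 → ∃ t, K2.map (suspToRel C) t = x) :
    Function.MulExact h.boundary (K2.map i) := by
  intro x
  refine ⟨fun hx => ?_, fun ⟨t, ht⟩ => ht ▸ h.map_boundary t⟩
  obtain ⟨δ, hδ⟩ := (isExtension_pullEv A).exists_boundaryOne
  obtain ⟨δ', hδ'⟩ := (isExtension_pullEv B).exists_boundaryOne
  have hnat := (isExtension_pullEv A).boundaryOne_natural hδ hδ' i.rel i.pull i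
    (fun _ => rfl) (fun w => (UGrp.ev_map i.toHom w).symm) x
  rw [hx, map_one] at hnat
  have hδx : δ x = 1 := by
    obtain ⟨a, ha⟩ := K1.mk_surjective _ (δ x)
    rw [← ha] at hnat ⊢
    rw [K1.map_mk, K1.mk_eq_one_iff] at hnat
    rw [K1.mk_eq_one_iff]
    have h1 : (⁅B.R, (⊤ : Subgroup (UGrp B.G))⁆) =
        (⁅A.R, (⊤ : Subgroup (UGrp A.G))⁆).map (UGrp.map i.toHom) := by
      rw [Subgroup.map_commutator,
        Subgroup.map_top_of_surjective _ (UGrp.map_surjective h.bijective.2)]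
      congr 1
      ext w
      obtain ⟨w, rfl⟩ := UGrp.map_surjective h.bijective.2 w
      rw [Subgroup.mem_map_iff_mem (UGrp.map_injective h.bijective.1)]
      change UGrp.ev _ = 1 ↔ UGrp.ev _ = 1
      rw [UGrp.ev_map, map_eq_one_iff _ h.bijective.1]
    have h2 : UGrp.map i.toHom a.1 ∈ ⁅B.R, (⊤ : Subgroup (UGrp B.G))⁆ := hnat
    rw [h1] at h2
    exact (Subgroup.mem_map_iff_mem (UGrp.map_injective h.bijective.1)).mp h2
  obtain ⟨y, rfl⟩ := ((isExtension_pullEv A).exact_K2_boundaryOne hδ x).mp hδx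
  rw [← i.map_pullEv] at hx
  obtain ⟨z, hz⟩ := ((isExtension_pullEv B).exact_K2 _).mp hx
  obtain ⟨z, rfl⟩ := (i.bijective_rel h.bijective).2 z
  rw [i.map_relToPull] at hz
  have hz' : K2.map (pullEv A) (K2.map (relToPull A) z) = 1 :=
    ((isExtension_pullEv A).exact_K2 _).mpr ⟨z, rfl⟩
  obtain ⟨t, ht⟩ := hC (K2.map h.pullToRel (y * (K2.map (relToPull A) z)⁻¹)) (by
    rw [h.map_relToPull_pullToRel, map_mul, map_inv, hz, mul_inv_cancel, map_one])
  refine ⟨t, ?_⟩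
  rw [h.boundary_eq ht.symm, map_mul, map_inv, hz', inv_one, mul_one]

/-- A class killed by the boundary comes, inside `K2 (rel C)`, from `K2 (rel A) ≅ K2 (rel B)`. `hB`
lifts it to `susp B`, and `hC` lets the comparison be made in `rel C`. -/
theorem exact_map_boundary_of_forall (h : IsExtension i p)
    (hB : ∀ x : K2 (rel B), K2.map (relToPull B) x = 1 → ∃ t, K2.map (suspToRel B) t = x)
    (hC : Function.Injective (K2.map (suspToRel C))) :
    Function.MulExact (K2.map p.susp) h.boundary := by
  intro x
  refine ⟨fun hx => ?_, fun ⟨z, hz⟩ => hz ▸ h.boundary_map z⟩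
  obtain ⟨y, hy⟩ := h.bijective_pullToRel.2 (K2.map (suspToRel C) x)
  rw [h.boundary_eq hy] at hx
  obtain ⟨y, rfl⟩ := ((isExtension_pullEv A).exact_K2 _).mp hx
  obtain ⟨z, hz⟩ := hB (K2.map i.rel y) (by
    apply h.bijective_pull.1
    rw [map_one, i.map_relToPull, ← h.map_relToPull_pullToRel, hy, K2.map_relToPull_suspToRel])
  refine ⟨z, hC ?_⟩
  rw [← hy, p.map_suspToRel, hz, h.map_pullToRel_relToPull]

theorem exact_susp_of_forall (h : IsExtension i p)
    (hA : ∀ x : K2 (rel A), K2.map (relToPull A) x = 1 → ∃ t, K2.map (suspToRel A) t = x)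
    (hB : Function.Injective (K2.map (suspToRel B))) :
    Function.MulExact (K2.map i.susp) (K2.map p.susp) := by
  intro x
  constructor
  · intro hx
    obtain ⟨y, hy⟩ := (i.bijective_rel h.bijective).2 (K2.map (suspToRel B) x)
    obtain ⟨z, hz⟩ := hA y (by
      apply h.bijective_pullToRel.1
      rw [map_one, h.map_pullToRel_relToPull, hy, ← p.map_suspToRel, hx, map_one])
    refine ⟨z, hB ?_⟩
    rw [← hy, ← hz, i.map_suspToRel]
  · rintro ⟨z, rfl⟩
    rw [K2.map_map_eq_map (k := p.susp.comp i.susp) (fun _ => rfl)]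
    exact K2.map_eq_one (susp_comp_eq_one i p h.comp_eq_one) z

theorem injective_susp_of_injective (h : IsExtension i p)
    (hA : Function.Injective (K2.map (suspToRel A))) :
    Function.Injective (K2.map i.susp) := by
  rw [injective_iff_map_eq_one]
  intro x hx
  apply hA
  apply (i.bijective_rel h.bijective).1
  rw [map_one, map_one, ← i.map_suspToRel, hx, map_one]

end IsExtension

/-! ### Reformulation of exactness of first and second order -/

/-- The projection `(J_E, U_E) → (J_{E/P}, F̄)`. -/
noncomputable def relToDerived (C : NormalPair.{u}) : Hom (rel C) (derived C) :=
  ⟨QuotientGroup.mk' C.J, fun x hx => ⟨x, hx, rfl⟩⟩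

/-- The projection from the preimage of `(P,E)` to `(J_{E/P} × P, F̄)`. -/
noncomputable def pullToDerivedProd (C : NormalPair.{u}) : Hom (pull C) (derivedProd C) :=
  ⟨QuotientGroup.mk' C.J, fun x hx => ⟨x, by rw [R_sup_V]; exact hx, rfl⟩⟩

theorem isExtension_relToDerived (C : NormalPair.{u}) :
    IsExtension (suspToRel C) (relToDerived C) where
  bijective := Function.bijective_id
  surjective := QuotientGroup.mk'_surjective C.J
  ker_eq := (QuotientGroup.ker_mk' C.J).trans (Subgroup.map_id (G := UGrp C.G) C.J).symm
  map_eq := rfl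

theorem isExtension_pullToDerivedProd (C : NormalPair.{u}) :
    IsExtension (suspToPull C) (pullToDerivedProd C) where
  bijective := Function.bijective_id
  surjective := QuotientGroup.mk'_surjective C.J
  ker_eq := (QuotientGroup.ker_mk' C.J).trans (Subgroup.map_id (G := UGrp C.G) C.J).symm
  map_eq := by
    change (C.N.comap UGrp.ev).map (QuotientGroup.mk' C.J) = (C.R ⊔ C.V).map _
    rw [R_sup_V]

/-- The pairs `rel C → derived C` and `pull C → derivedProd C` are extensions with the same kernel
`susp C`, hence with the same target `K1` of the boundary. Since `K2 (susp C) → K2 (pull C)` is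
trivial, comparing the two sequences gives both directions. -/
theorem exactFirst_iff (C : NormalPair.{u}) : C.ExactFirst ↔
    ∀ x : K2 (rel C), K2.map (relToPull C) x = 1 → ∃ t, K2.map (suspToRel C) t = x := by
  have e1 := isExtension_relToDerived C
  have e2 := isExtension_pullToDerivedProd C
  have hsq : ∀ x, K2.map (derivedIncl C) (K2.map (relToDerived C) x) =
      K2.map (pullToDerivedProd C) (K2.map (relToPull C) x) := K2.map_map_eq (fun _ => rfl)
  constructor
  · intro hC x hx
    refine (e1.exact_K2 x).mp (hC ?_)
    rw [hsq, hx, map_one, map_one]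
  · intro hC
    rw [ExactFirst, injective_iff_map_eq_one]
    intro x hx
    obtain ⟨δ, hδ⟩ := e1.exists_boundaryOne
    obtain ⟨δ', hδ'⟩ := e2.exists_boundaryOne
    let f : Hom (susp C) (susp C) := ⟨MonoidHom.id _, fun _ hx => hx⟩
    have hnat := e1.boundaryOne_natural hδ hδ' f (relToPull C) (derivedIncl C)
      (fun _ => rfl) (fun _ => rfl) x
    have hf : ∀ y, K1.map f y = y := by
      intro y
      obtain ⟨a, rfl⟩ := K1.mk_surjective _ y
      rfl
    rw [hx, map_one, hf] at hnat
    obtain ⟨y, rfl⟩ := (e1.exact_K2_boundaryOne hδ x).mp hnat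
    rw [hsq] at hx
    obtain ⟨z, hz⟩ := (e2.exact_K2 _).mp hx
    rw [K2.map_suspToPull] at hz
    exact (e1.exact_K2 y).mpr (hC y hz.symm)

theorem isFreeGroup_of_injective {G H : Type u} [Group G] [Group H] [IsFreeGroup H] (f : G →* H)
    (hf : Function.Injective f) : IsFreeGroup G :=
  IsFreeGroup.ofMulEquiv (MonoidHom.ofInjective hf).symm

/-- An element of `J_F` that dies in `U_{F/N}` lies in `J_{N,F}`, so this group embeds in `U_{F/N}`.
-/
instance (A : NormalPair.{u}) : IsFreeGroup (derived A).N := by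
  let f : UGrp A.G ⧸ A.J →* UGrp (A.G ⧸ A.N) :=
    QuotientGroup.lift A.J (UGrp.map (QuotientGroup.mk' A.N)) fun _ hw => hw.1
  refine isFreeGroup_of_injective (f.comp (derived A).N.subtype) ?_
  rw [injective_iff_map_eq_one]
  rintro ⟨_, w, hw, rfl⟩ h1
  exact Subtype.ext ((QuotientGroup.eq_one_iff w).mpr ⟨h1, hw⟩)

/-- Put `D = derived A`. As `D.N` is free, `K2 (susp D)` vanishes, and first order exactness of `D`
means that `K2 (rel D) → K2 (pull D)` is injective. Comparing quotients, this map is `K2 (susp A) →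
K2 (rel A)`: the quotients are `U_F / J_{N,F}` and `F`. -/
theorem exactSecond_iff (A : NormalPair.{u}) :
    A.ExactSecond ↔ Function.Injective (K2.map (suspToRel A)) := by
  let D := derived A
  have h1 : A.ExactSecond ↔ Function.Injective (K2.map (relToPull D)) := by
    rw [ExactSecond, exactFirst_iff, injective_iff_map_eq_one]
    refine forall₂_congr fun x _ => ⟨?_, fun hx => ⟨1, by rw [map_one, hx]⟩⟩
    rintro ⟨t, rfl⟩
    rw [K2.susp_eq_one _ t, map_one]
  let q₁ : Hom (pull (susp A)) (rel D) := ⟨UGrp.map (QuotientGroup.mk' A.J),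
    fun (w : UGrp (UGrp A.G)) hw => by
    change UGrp.ev (UGrp.map (QuotientGroup.mk' A.J) w) = 1
    rw [UGrp.ev_map]
    exact (QuotientGroup.eq_one_iff _).mpr hw⟩
  let q₂ : Hom (pull (rel A)) (pull D) := ⟨UGrp.map (QuotientGroup.mk' A.J),
    fun (w : UGrp (UGrp A.G)) hw => by
    change UGrp.ev (UGrp.map (QuotientGroup.mk' A.J) w) ∈ A.R.map (QuotientGroup.mk' A.J)
    rw [UGrp.ev_map]
    exact ⟨_, hw, rfl⟩⟩
  have b₁ : Function.Bijective (K2.map q₁) := by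
    refine K2.map_bijective_of_free q₁ (UGrp.map_surjective (QuotientGroup.mk'_surjective A.J)) ?_
    intro (w : UGrp (UGrp A.G)) hw
    have hw' : UGrp.ev (UGrp.map (QuotientGroup.mk' A.J) w) = 1 := hw
    rw [UGrp.ev_map] at hw'
    exact (QuotientGroup.eq_one_iff (UGrp.ev w)).mp hw'
  have b₂ : Function.Bijective (K2.map q₂) := by
    refine K2.map_bijective_of_free q₂ (UGrp.map_surjective (QuotientGroup.mk'_surjective A.J)) ?_
    intro (w : UGrp (UGrp A.G)) hw
    have hw' : UGrp.ev (UGrp.map (QuotientGroup.mk' A.J) w) ∈ A.R.map (QuotientGroup.mk' A.J) := hw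
    rw [UGrp.ev_map] at hw'
    obtain ⟨r, hr, e⟩ := hw'
    have h2 := QuotientGroup.eq.mp e
    have h3 := mul_mem hr (inf_le_right (a := A.V) h2)
    rwa [mul_inv_cancel_left] at h3
  have c₁ : Function.Bijective (K2.map (pullEv (susp A))) :=
    K2.map_bijective_of_free _ UGrp.ev_surjective fun _ hw => hw
  have c₂ : Function.Bijective (K2.map (pullEv (rel A))) :=
    K2.map_bijective_of_free _ UGrp.ev_surjective fun _ hw => hw
  have s₁ : K2.map (relToPull D) ∘ K2.map q₁ = K2.map q₂ ∘ K2.map (suspToRel A).pull :=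
    funext (K2.map_map_eq fun (w : UGrp (UGrp A.G)) => by
      change UGrp.map (QuotientGroup.mk' A.J) w = UGrp.map (QuotientGroup.mk' A.J)
        (UGrp.map (MonoidHom.id (UGrp A.G)) w)
      rw [UGrp.map_map]
      rfl)
  have s₂ : K2.map (suspToRel A) ∘ K2.map (pullEv (susp A)) =
      K2.map (pullEv (rel A)) ∘ K2.map (suspToRel A).pull :=
    funext (K2.map_map_eq fun w => (UGrp.ev_map (suspToRel A).toHom w).symm)
  rw [h1, ← Function.Injective.of_comp_iff' _ b₁, s₁, b₂.1.of_comp_iff,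
    ← c₂.1.of_comp_iff, ← s₂, Function.Injective.of_comp_iff' _ c₁]

end NormalPair

/-! ### Subgroups of free abelian groups -/

/-- A submodule of a free module over a principal ideal domain is free. -/
theorem Submodule.free_of_finsupp {R ι : Type*} [CommRing R] [IsDomain R] [IsPrincipalIdealRing R]
    (N : Submodule R (ι →₀ R)) : Module.Free R N := by
  -- With `ι` well ordered, `I i` is the ideal of leading coefficients at `i` and `n i` realizes its
  -- generator `a i`. The `n i` with `a i ≠ 0` form a triangular basis.
  obtain ⟨_, _⟩ := exists_wellFoundedLT ι
  let L : ι → Submodule R (ι →₀ R) := fun i => N ⊓ Finsupp.supported R R (Set.Iic i)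
  let I : ι → Ideal R := fun i => (L i).map (Finsupp.lapply i)
  let a : ι → R := fun i => Submodule.IsPrincipal.generator (I i)
  have ha : ∀ i, ∃ n ∈ L i, n i = a i := fun i => Submodule.IsPrincipal.generator_mem (I i)
  choose n hn hna using ha
  have hn0 : ∀ i k, i < k → n i k = 0 := by
    intro i k hik
    by_contra h0
    exact not_le.mpr hik ((hn i).2 (Finsupp.mem_support_iff.mpr h0))
  let b : {i // a i ≠ 0} → (ι →₀ R) := fun i => n i
  have hli : LinearIndependent R b := by
    refine linearIndependent_iff.mpr fun l hl => ?_
    by_contra hne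
    let j := l.support.max' (Finsupp.support_nonempty_iff.mpr hne)
    have hj : j ∈ l.support := Finset.max'_mem _ _
    have h1 : (Finsupp.linearCombination R b l) j = l j * a j := by
      rw [Finsupp.linearCombination_apply, Finsupp.sum, Finsupp.finsetSum_apply,
        Finset.sum_eq_single j]
      · change l j * n j j = _
        rw [hna]
      · intro k hk hkj
        change l k * n k j = 0
        rw [hn0 k j (lt_of_le_of_ne (Finset.le_max' _ k hk) fun e => hkj (Subtype.ext e)), mul_zero]
      · exact fun h => absurd hj h
    rw [hl] at h1
    exact mul_ne_zero (Finsupp.mem_support_iff.mp hj) j.2 h1.symm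
  have hmax : ∀ (P : ι → Prop) (x : ι →₀ R), (∀ i, x i ≠ 0 → P i) →
      x = 0 ∨ ∃ i, P i ∧ ∀ k, i < k → x k = 0 := by
    intro P x hP
    by_cases h0 : x = 0
    · exact Or.inl h0
    · have hne := Finsupp.support_nonempty_iff.mpr h0
      refine Or.inr ⟨x.support.max' hne,
        hP _ (Finsupp.mem_support_iff.mp (Finset.max'_mem _ hne)), fun k hk => ?_⟩
      by_contra h1
      exact not_le.mpr hk (Finset.le_max' _ k (Finsupp.mem_support_iff.mpr h1))
  have hspan : ∀ i, ∀ x ∈ N, (∀ k, i < k → x k = 0) → x ∈ Submodule.span R (Set.range b) := by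
    intro i
    induction i using WellFoundedLT.induction with
    | ind i ih =>
    intro x hxN hx
    have hlt : ∀ y ∈ N, (∀ k, i ≤ k → y k = 0) → y ∈ Submodule.span R (Set.range b) := by
      intro y hyN hy
      obtain rfl | ⟨j, hj, hj'⟩ := hmax (· < i) y fun k hk => not_le.mp fun h => hk (hy k h)
      · exact zero_mem _
      · exact ih j hj y hyN hj'
    have hxI : x i ∈ I i := ⟨x, ⟨hxN, fun k hk => by
      by_contra hle
      exact Finsupp.mem_support_iff.mp hk (hx k (not_le.mp hle))⟩, rfl⟩
    obtain ⟨c, hc⟩ := (Submodule.IsPrincipal.mem_iff_eq_smul_generator (I i)).mp hxI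
    replace hc : x i = c * a i := hc
    by_cases hai : a i = 0
    · refine hlt x hxN fun k hk => ?_
      rcases hk.eq_or_lt with rfl | hk
      · rw [hc, hai, mul_zero]
      · exact hx k hk
    · have : x - c • n i ∈ Submodule.span R (Set.range b) := by
        refine hlt _ (sub_mem hxN (Submodule.smul_mem _ c (hn i).1)) fun k hk => ?_
        rw [Finsupp.sub_apply, Finsupp.smul_apply, smul_eq_mul]
        rcases hk.eq_or_lt with rfl | hk
        · rw [hna, hc, sub_self]
        · rw [hx k hk, hn0 i k hk, mul_zero, sub_self]
      have h2 := add_mem this (Submodule.smul_mem _ c (Submodule.subset_span ⟨⟨i, hai⟩, rfl⟩))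
      rwa [sub_add_cancel] at h2
  have hN : N = Submodule.span R (Set.range b) := by
    apply le_antisymm
    · intro x hx
      obtain rfl | ⟨j, -, hj⟩ := hmax (fun _ => True) x fun _ _ => trivial
      · exact zero_mem _
      · exact hspan j x hx hj
    · rw [Submodule.span_le]
      rintro _ ⟨i, rfl⟩
      exact (hn i).1
  rw [hN]
  exact Module.Free.of_basis (Module.Basis.span hli)

/-- The image of `f` is free abelian, so `f` splits over it by some `S`. Then `k / S k` lies in the
kernel of `f`, which is the image of `c`. -/
theorem MonoidHom.exists_retraction_of_finsupp {L K ι : Type*} [CommGroup L] [CommGroup K]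
    (c : L →* K) (hc : Function.Injective c) (f : K →* Multiplicative (ι →₀ ℤ))
    (hcf : ∀ k, f k = 1 ↔ k ∈ c.range) : ∃ r : K →* L, ∀ l, r (c l) = l := by
  let F : Additive K →ₗ[ℤ] (ι →₀ ℤ) := (MonoidHom.toAdditiveLeft f).toIntLinearMap
  have := Submodule.free_of_finsupp F.range
  obtain ⟨s, hs⟩ := Module.projective_lifting_property F.rangeRestrict LinearMap.id
    F.surjective_rangeRestrict
  let S : K →* K := AddMonoidHom.toMultiplicative (s ∘ₗ F.rangeRestrict).toAddMonoidHom
  have hS : ∀ k, f (S k) = f k := fun k =>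
    congrArg Subtype.val (LinearMap.congr_fun hs (F.rangeRestrict (Additive.ofMul k)))
  have hS1 : ∀ k, f k = 1 → S k = 1 := by
    intro k hk
    have h0 : F.rangeRestrict (Additive.ofMul k) = 0 := Subtype.ext hk
    change s (F.rangeRestrict (Additive.ofMul k)) = 0
    rw [h0, map_zero]
  let e := MonoidHom.ofInjective hc
  refine ⟨e.symm.toMonoidHom.comp (((MonoidHom.id K) / S).codRestrict c.range fun k => ?_),
    fun l => ?_⟩
  · rw [← hcf, MonoidHom.div_apply, map_div, hS]
    exact div_self' _
  · apply e.injective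
    refine (e.apply_symm_apply _).trans (Subtype.ext ?_)
    change c l / S (c l) = c l
    rw [hS1 _ ((hcf _).mpr ⟨l, rfl⟩), div_one]

namespace NormalPair

variable {A B C : NormalPair.{u}}

/-! ### Splitting at `K^J_2(P,E)` -/

theorem J_inf_commutator_le_Z : A.J ⊓ ⁅(⊤ : Subgroup (UGrp A.G)), ⊤⁆ ≤ A.Z := by
  rintro w ⟨hw, hw'⟩
  obtain ⟨s, hs⟩ := IsFreeGroup.exists_lift (UGrp.map (QuotientGroup.mk' A.N)) (MonoidHom.id _)
    (UGrp.map_surjective (QuotientGroup.mk'_surjective _))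
  exact ⟨hw, MonoidHom.ker_inf_commutator_le _ s hs ⟨hw.1, hw'⟩⟩

theorem T_le_Z : A.T ≤ A.Z := le_inf T_le_J T_le_commutator

/-- `K^J_2(N,F)` is a direct factor of `J_{N,F}` modulo trivial elements. -/
theorem exists_retraction_J (A : NormalPair.{u}) :
    ∃ ρ : A.J →* A.K2, ∀ (j : A.J) (hj : (j : UGrp A.G) ∈ A.Z), ρ j = K2.mk A ⟨j, hj⟩ := by
  let K := A.J ⧸ A.T.subgroupOf A.J
  let _ : CommGroup K :=
    { (inferInstance : Group K) with
      mul_comm := by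
        intro a b
        obtain ⟨a, rfl⟩ := QuotientGroup.mk'_surjective _ a
        obtain ⟨b, rfl⟩ := QuotientGroup.mk'_surjective _ b
        exact Subgroup.mk_commute_of_commutator_le (K := ⊤) (L := ⊤) (T := A.T.subgroupOf A.J) (by
          rw [Subgroup.commutator_le]
          intro g _ k _
          exact J_commutator_le_T
            (Subgroup.commutator_mem_commutator g.2 (Subgroup.mem_top (k : UGrp A.G))))
          (Subgroup.mem_top a) (Subgroup.mem_top b) }
  let c : A.K2 →* K := QuotientGroup.map (A.T.subgroupOf A.Z) (A.T.subgroupOf A.J)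
    (Subgroup.inclusion inf_le_left) fun _ hw => hw
  have hc : Function.Injective c := by
    rw [injective_iff_map_eq_one]
    intro x hx
    obtain ⟨z, rfl⟩ := K2.mk_surjective A x
    exact K2.mk_eq_one_iff.mpr
      ((QuotientGroup.eq_one_iff (Subgroup.inclusion inf_le_left z : A.J)).mp hx)
  -- By `J_inf_commutator_le_Z`, the kernel of `J / T → U_F^{ab}` is exactly `K2`, and `U_F^{ab}` is
  -- free abelian.
  let g : UGrp A.G →* Multiplicative ({x : A.G // x ≠ 1} →₀ ℤ) :=
    (AddMonoidHom.toMultiplicativeRight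
      (FreeAbelianGroup.equivFinsupp {x : A.G // x ≠ 1}).toAddMonoidHom).comp Abelianization.of
  have hg : ∀ w, g w = 1 ↔ w ∈ ⁅(⊤ : Subgroup (UGrp A.G)), (⊤ : Subgroup (UGrp A.G))⁆ := by
    intro w
    rw [← commutator_def, ← Abelianization.ker_of, MonoidHom.mem_ker]
    exact (FreeAbelianGroup.equivFinsupp {x : A.G // x ≠ 1}).map_eq_zero_iff
      (x := Additive.ofMul (Abelianization.of w))
  have hT : A.T ≤ ⁅(⊤ : Subgroup (UGrp A.G)), ⊤⁆ :=
    T_le_commutator.trans (Subgroup.commutator_mono le_top le_rfl)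
  let f : K →* Multiplicative ({x : A.G // x ≠ 1} →₀ ℤ) :=
    QuotientGroup.lift _ (g.comp A.J.subtype) fun w hw =>
      (hg w).mpr (hT hw)
  obtain ⟨r, hr⟩ := MonoidHom.exists_retraction_of_finsupp c hc f (by
    intro k
    obtain ⟨j, rfl⟩ := QuotientGroup.mk'_surjective _ k
    constructor
    · intro hk
      exact ⟨K2.mk A ⟨j, J_inf_commutator_le_Z ⟨j.2, (hg j).mp hk⟩⟩, rfl⟩
    · rintro ⟨x, hx⟩
      obtain ⟨z, rfl⟩ := K2.mk_surjective A x
      rw [← hx]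
      exact (hg z).mpr (Subgroup.commutator_mono le_top le_rfl z.2.2))
  exact ⟨r.comp (QuotientGroup.mk' _), fun j hj => hr (K2.mk A ⟨j, hj⟩)⟩

/-- A class of `K2 C` is represented by a commutator `w` over `(M,F)` whose evaluation lies in `N ∩
[M,F]`. Admissibility supplies `x ∈ X` with the same evaluation. Then `w * x⁻¹` lies in `J_{M,F}`,
and the retraction `ρ` sends it to `K2 B`, from where it goes to `K2 C`. Other choices change it by
`B.T` and the image of `A.Z`, which die in `K2 C`; for classes from `K2 B` one may take `x = 1`. -/
theorem IsExtension.exists_projection {i : Hom A B} {p : Hom B C} (h : IsExtension i p)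
    (hA : A.PartiallyAdmissible (A.N ⊓ (⁅B.N, (⊤ : Subgroup B.G)⁆).comap i.toHom)) :
    ∃ r : K2 C →* K2 C, (∀ x, r x ∈ (K2.map p).range) ∧ ∀ x ∈ (K2.map p).range, r x = x := by
  obtain ⟨X₀, -, hXV, hVX, hXJ, hXN⟩ := hA
  let X : Subgroup (UGrp A.G) := X₀.comap (QuotientGroup.mk' A.T)
  have hle : ∀ {Y : Subgroup (UGrp A.G)}, A.T ≤ Y → ∀ w,
      QuotientGroup.mk' A.T w ∈ Y.map (QuotientGroup.mk' A.T) → w ∈ Y := by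
    rintro Y hY w ⟨y, hy, e⟩
    have := mul_mem hy (hY (QuotientGroup.eq.mp e))
    rwa [mul_inv_cancel_left] at this
  have hX₁ : ∀ w ∈ X, w ∈ A.V := fun w hw => hle (T_le_J.trans inf_le_left) w (hXV hw)
  have hX₂ : ∀ w ∈ ⁅A.V, (⊤ : Subgroup (UGrp A.G))⁆, w ∈ X := fun w hw => hVX ⟨w, hw, rfl⟩
  have hX₃ : ∀ w ∈ X, UGrp.ev w = 1 → w ∈ A.Z := fun w hw hw' => hle T_le_Z w (by
    rw [← hXJ]
    exact ⟨hw, w, ⟨hX₁ w hw, hw'⟩, rfl⟩)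
  obtain ⟨ρ, hρ⟩ := exists_retraction_J B
  have hρT : ∀ j k : B.J, (j : UGrp B.G) * (k : UGrp B.G)⁻¹ ∈ B.T → ρ j = ρ k := by
    intro j k hjk
    rw [← div_eq_one, ← map_div, hρ _ (by
      rw [div_eq_mul_inv]
      exact T_le_Z hjk), K2.mk_eq_one_iff]
    change ((j / k : B.J) : UGrp B.G) ∈ B.T
    rw [div_eq_mul_inv]
    exact hjk
  let Y : Subgroup (UGrp B.G × UGrp A.G) :=
    (⁅B.V, (⊤ : Subgroup (UGrp B.G))⁆ ⊓ C.Z.comap (UGrp.map p.toHom)).prod X ⊓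
      MonoidHom.eqLocus (UGrp.ev.comp (MonoidHom.fst _ _))
        ((i.toHom.comp UGrp.ev).comp (MonoidHom.snd _ _))
  have hY : ∀ y : Y, UGrp.ev y.1.1 = i.toHom (UGrp.ev y.1.2) := fun y => y.2.2
  have hYJ : ∀ y : Y, y.1.1 * (UGrp.map i.toHom y.1.2)⁻¹ ∈ B.J := fun y =>
    ⟨B.V.mul_mem (commutator_V_le y.2.1.1.1) (B.V.inv_mem (i.map_V (hX₁ _ y.2.1.2))), by
      change UGrp.ev _ = 1
      rw [map_mul, map_inv, UGrp.ev_map, hY, mul_inv_cancel]⟩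
  let q : Y →* K2 C := (K2.mk C).comp
    (((UGrp.map p.toHom).comp ((MonoidHom.fst _ _).comp Y.subtype)).codRestrict C.Z
      fun y => y.2.1.1.2)
  have hq : Function.Surjective q := by
    intro x
    obtain ⟨y, rfl⟩ := K2.mk_surjective C x
    obtain ⟨w, hw, hw', a, ha, e⟩ := h.exists_lift_Z y.2
    have ha' : a ∈ X.map UGrp.ev := by
      rw [hXN]
      refine ⟨ha, ?_⟩
      change i.toHom a ∈ ⁅B.N, (⊤ : Subgroup B.G)⁆
      rw [← map_ev_commutator]
      exact ⟨w, hw, e⟩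
    obtain ⟨x, hx, rfl⟩ := ha'
    refine ⟨⟨(w, x), ⟨⟨hw, ?_⟩, hx⟩, e⟩, congrArg (K2.mk C) (Subtype.ext hw')⟩
    change UGrp.map p.toHom w ∈ C.Z
    rw [hw']
    exact y.2
  let s : Y →* K2 C := (K2.map p).comp (MonoidHom.mk' (fun y => ρ ⟨_, hYJ y⟩) (by
    intro y z
    rw [← map_mul]
    apply hρT
    change y.1.1 * z.1.1 * (UGrp.map i.toHom (y.1.2 * z.1.2))⁻¹ *
      (y.1.1 * (UGrp.map i.toHom y.1.2)⁻¹ * (z.1.1 * (UGrp.map i.toHom z.1.2)⁻¹))⁻¹ ∈ B.T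
    have h1 := J_commutator_le_T (Subgroup.commutator_mem_commutator (hYJ z)
      (Subgroup.mem_top (UGrp.map i.toHom y.1.2)⁻¹))
    have e : ∀ a b c d : UGrp B.G, a * b * (c * d)⁻¹ * (a * c⁻¹ * (b * d⁻¹))⁻¹ =
        a * ⁅b * d⁻¹, c⁻¹⁆ * a⁻¹ := by
      intro a b c d
      rw [commutatorElement_def]
      group
    rw [map_mul, e]
    exact (inferInstance : B.T.Normal).conj_mem _ h1 y.1.1))
  have hs : ∀ y, s y = K2.map p (ρ ⟨_, hYJ y⟩) := fun _ => rfl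
  have hqs : q.ker ≤ s.ker := by
    intro y hy
    have hy' : UGrp.map p.toHom y.1.1 ∈ C.T := K2.mk_eq_one_iff.mp hy
    rw [← h.map_map_T] at hy'
    obtain ⟨t, ht, e⟩ := hy'
    obtain ⟨a, ha, ha'⟩ := h.mem_map_commutator (w := t⁻¹ * y.1.1)
      (by rw [map_mul, map_inv, e, inv_mul_cancel])
      (mul_mem (inv_mem (T_le_commutator ht)) y.2.1.1.1)
    have hz : a * y.1.2⁻¹ ∈ A.Z := by
      refine hX₃ _ (mul_mem (hX₂ a ha) (inv_mem y.2.1.2)) ?_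
      apply h.bijective.1
      have ht' : UGrp.ev t = 1 := (T_le_J ht).2
      rw [map_mul, map_inv, map_mul, map_inv, ← hY, ← UGrp.ev_map, ha', map_mul, map_inv, ht',
        inv_one, one_mul, mul_inv_cancel, map_one]
    have e2 : y.1.1 * (UGrp.map i.toHom y.1.2)⁻¹ = t * UGrp.map i.toHom (a * y.1.2⁻¹) := by
      rw [map_mul, map_inv, ha']
      group
    have hZ : y.1.1 * (UGrp.map i.toHom y.1.2)⁻¹ ∈ B.Z := by
      rw [e2]
      exact mul_mem (T_le_Z ht) (i.map_Z hz)
    rw [MonoidHom.mem_ker, hs, hρ _ hZ, K2.map_mk, K2.mk_eq_one_iff]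
    change UGrp.map p.toHom (y.1.1 * (UGrp.map i.toHom y.1.2)⁻¹) ∈ C.T
    rw [e2, map_mul, h.mem_V_iff.mp hz.1.1, mul_one]
    exact p.map_T ht
  have hr : ∀ y, q.liftOfSurjective hq ⟨s, hqs⟩ (q y) = s y := fun y =>
    MonoidHom.liftOfRightInverse_comp_apply _ _ _ _ _
  refine ⟨q.liftOfSurjective hq ⟨s, hqs⟩, fun x => ?_, ?_⟩
  · obtain ⟨y, rfl⟩ := hq x
    rw [hr]
    exact ⟨_, rfl⟩
  · rintro _ ⟨x, rfl⟩
    obtain ⟨z, rfl⟩ := K2.mk_surjective B x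
    have hz : UGrp.ev (z : UGrp B.G) = 1 := z.2.1.2
    let y : Y := ⟨(z, 1), ⟨⟨z.2.2, p.map_Z z.2⟩, one_mem _⟩, by
      change UGrp.ev (z : UGrp B.G) = i.toHom (UGrp.ev 1)
      rw [hz, map_one, map_one]⟩
    have e1 : K2.map p (K2.mk B z) = q y := rfl
    have e2 : (z : UGrp B.G) * (UGrp.map i.toHom (1 : UGrp A.G))⁻¹ = z := by
      rw [map_one, inv_one, mul_one]
    rw [e1, hr, hs, hρ _ (by
      change (z : UGrp B.G) * (UGrp.map i.toHom (1 : UGrp A.G))⁻¹ ∈ B.Z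
      rw [e2]
      exact z.2), ← e1]
    congr 2
    exact Subtype.ext e2

end NormalPair

namespace NormalPair

variable {A B C : NormalPair.{u}}

/-! ### Vanishing in higher degrees -/

instance (A : NormalPair.{u}) : IsFreeGroup (susp A).N := inferInstanceAs (IsFreeGroup A.J)
instance (A : NormalPair.{u}) : IsFreeGroup (pull A).N :=
  inferInstanceAs (IsFreeGroup (A.N.comap UGrp.ev))

/-- From the second suspension on, the kernel being suspended is a subgroup of a free group, hence
free. -/
theorem KJ.eq_one (k : ℕ) (x : KJ (k + 2) A) : x = 1 :=
  K2.susp_eq_one (susp (iterSusp k A)) x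

theorem Hom.bijective_iterSusp (f : Hom A B) (hf : Function.Bijective f.toHom) (k : ℕ) :
    Function.Bijective (f.iterSusp k).toHom := by
  induction k with
  | zero => exact hf
  | succ k ih => exact ⟨UGrp.map_injective ih.1, UGrp.map_surjective ih.2⟩

theorem exists_isExtension (f : Hom A B) (hf : Function.Bijective f.toHom) :
    ∃ (C : NormalPair.{u}) (p : Hom B C), IsExtension f p := by
  have h₁ : (A.N.map f.toHom).Normal := Subgroup.Normal.map inferInstance _ hf.2
  have h₂ : (B.N.map (QuotientGroup.mk' (A.N.map f.toHom))).Normal :=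
    Subgroup.Normal.map inferInstance _ (QuotientGroup.mk'_surjective _)
  refine ⟨⟨B.G ⧸ A.N.map f.toHom, B.N.map (QuotientGroup.mk' (A.N.map f.toHom))⟩,
    ⟨QuotientGroup.mk' _, fun x hx => ⟨x, hx, rfl⟩⟩, hf, QuotientGroup.mk'_surjective _,
    QuotientGroup.ker_mk' _, rfl⟩

/-- Since `J_{M,F} ∩ U_{N,F} = J_{N,F}`, the quotient `J_{M,F} / J_{N,F}` embeds in `U_E`. -/
theorem IsExtension.isFreeGroup_susp {C' : NormalPair.{u}} {i : Hom A B} {p : Hom B C}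
    {p' : Hom (susp B) C'} (h : IsExtension i p) (h' : IsExtension i.susp p') :
    IsFreeGroup C'.N := by
  have hker : p'.toHom.ker = A.J.map (UGrp.map i.toHom) := h'.ker_eq
  have hle : p'.toHom.ker ≤ (UGrp.map p.toHom).ker := by
    rw [hker, ← h.map_V_eq]
    exact Subgroup.map_mono inf_le_left
  let φ : C'.G →* UGrp C.G := p'.toHom.liftOfSurjective h'.surjective ⟨UGrp.map p.toHom, hle⟩
  have hφ : ∀ w, φ (p'.toHom w) = UGrp.map p.toHom w := fun w =>
    MonoidHom.liftOfRightInverse_comp_apply _ _ _ _ w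
  refine isFreeGroup_of_injective (φ.comp C'.N.subtype) ?_
  rw [injective_iff_map_eq_one]
  rintro ⟨y, hy⟩ hy'
  apply Subtype.ext
  change y = 1
  rw [← h'.map_eq] at hy
  obtain ⟨w, hw, rfl⟩ := hy
  have h1 : w ∈ (UGrp.map p.toHom).ker := (hφ w).symm.trans hy'
  rw [← h.map_V_eq] at h1
  obtain ⟨v, hv, rfl⟩ := h1
  have h2 : UGrp.ev (UGrp.map i.toHom v) = 1 := hw.2
  rw [UGrp.ev_map, map_eq_one_iff _ h.bijective.1] at h2
  change _ ∈ p'.toHom.ker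
  rw [hker]
  exact ⟨v, ⟨hv, h2⟩, rfl⟩

/-- By `boundary_cone` this map factors through `K2 (susp C')`, where `C'` is the quotient pair of
`i.susp`; that group vanishes because `C'.N` is free. So the zero map is a boundary map in higher
degrees. -/
theorem K2.map_coneFst_susp {i : Hom A B} (hi : Function.Bijective i.toHom)
    (x : K2 (cone i.susp)) : K2.map (coneFst i.susp) x = 1 := by
  obtain ⟨C, p, h⟩ := exists_isExtension i hi
  obtain ⟨C', p', h'⟩ := exists_isExtension i.susp (i.bijective_iterSusp hi 1)
  have := h.isFreeGroup_susp h'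
  rw [← h'.boundary_cone, K2.susp_eq_one C' (K2.map _ x), map_one]

theorem IsExtension.isBoundary_succ {i : Hom A B} {p : Hom B C} (h : IsExtension i p) (k : ℕ) :
    IsBoundary h (k + 1) 1 := fun x =>
  (K2.map_coneFst_susp (i := i.iterSusp k) (i.bijective_iterSusp h.bijective k) x).symm

/-! ### Necessity of the conditions -/

/-- The projection `(J_{E/P} × P, F̄) → (P,E)`. -/
noncomputable def derivedProdEv (C : NormalPair.{u}) : Hom (derivedProd C) C :=
  ⟨QuotientGroup.lift C.J UGrp.ev fun _ hw => hw.2, by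
    rintro _ ⟨w, hw, rfl⟩
    rw [R_sup_V] at hw
    exact hw⟩

theorem isExtension_derivedProdEv (C : NormalPair.{u}) :
    IsExtension (derivedIncl C) (derivedProdEv C) where
  bijective := Function.bijective_id
  surjective := fun x => ⟨QuotientGroup.mk' C.J (UGrp.u x), UGrp.ev_u x⟩
  ker_eq := by
    refine Eq.trans ?_ (Subgroup.map_id (G := UGrp C.G ⧸ C.J) _).symm
    ext x
    obtain ⟨w, rfl⟩ := QuotientGroup.mk'_surjective C.J x
    refine ⟨fun hw => ⟨w, hw, rfl⟩, ?_⟩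
    rintro ⟨v, hv, e⟩
    rw [← e]
    exact hv
  map_eq := by
    apply le_antisymm (Subgroup.map_le_iff_le_comap.mpr (derivedProdEv C).mem)
    intro x hx
    refine ⟨QuotientGroup.mk' C.J (UGrp.u x), ⟨UGrp.u x, ?_, rfl⟩, UGrp.ev_u x⟩
    exact (le_sup_right : C.V ≤ C.R ⊔ C.V) (u_mem_V hx)

/-- The suspension of `(J_{E/P} × P, F̄) → (P,E)` has a section. -/
theorem exists_section_susp_derivedProdEv (C : NormalPair.{u}) :
    ∃ s : Hom (susp C) (susp (derivedProd C)),
      ∀ w, (derivedProdEv C).susp.toHom (s.toHom w) = w := by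
  -- The index of the new generator is the class of `u_x` itself, so `σ w` evaluates to the class of
  -- `w`, which is trivial on `J_{P,E}`.
  let σ : UGrp C.G →* UGrp (derivedProd C).G :=
    FreeGroup.lift fun x => UGrp.u (F := (derivedProd C).G) (QuotientGroup.mk' C.J (UGrp.u x.1))
  let q : UGrp C.G →* (derivedProd C).G := QuotientGroup.mk' C.J
  have hσ : ∀ x, σ (UGrp.u x) = UGrp.u (q (UGrp.u x)) := by
    intro x
    by_cases hx : x = 1
    · rw [hx, UGrp.u_one, map_one, map_one, UGrp.u_one]
    · conv_lhs => rw [UGrp.u, dif_neg hx]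
      exact FreeGroup.lift_apply_of
  have hev : UGrp.ev.comp σ = q := UGrp.hom_ext fun x => by
    rw [MonoidHom.comp_apply, hσ, UGrp.ev_u]
  have hmap : (UGrp.map (derivedProdEv C).toHom).comp σ = MonoidHom.id _ :=
    UGrp.hom_ext fun x => by
      rw [MonoidHom.comp_apply, hσ, UGrp.map_u]
      exact congrArg UGrp.u (UGrp.ev_u x)
  have hmap' : ∀ w, UGrp.map (derivedProdEv C).toHom (σ w) = w := DFunLike.congr_fun hmap
  refine ⟨⟨σ, fun (w : UGrp C.G) hw => ⟨?_, ?_⟩⟩, hmap'⟩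
  · refine (isExtension_derivedProdEv C).mem_V_iff_map.mpr ?_
    change UGrp.map (derivedProdEv C).toHom (σ w) ∈ C.V
    rw [hmap']
    exact hw.1
  · exact (DFunLike.congr_fun hev w).trans ((QuotientGroup.eq_one_iff _).mpr hw)

/-- Test on `derived C → derivedProd C → C`. The suspended projection has a section, so the boundary
is zero and exactness becomes injectivity. -/
theorem exactFirst_of_exact (h : ∀ (A' B' : NormalPair.{u}) (i' : Hom A' B') (p' : Hom B' C)
    (h' : IsExtension i' p') (δ : KJ 1 C →* KJ 0 A'), IsBoundary h' 0 δ →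
    Function.MulExact δ (KJ.map 0 i')) : C.ExactFirst := by
  have hext := isExtension_derivedProdEv C
  have hex := h _ _ _ _ hext hext.boundary hext.boundary_cone
  obtain ⟨s, hs⟩ := exists_section_susp_derivedProdEv C
  rw [ExactFirst, injective_iff_map_eq_one]
  intro x hx
  obtain ⟨t, rfl⟩ := (hex x).mp hx
  have ht : K2.map (derivedProdEv C).susp (K2.map s t) = t := K2.map_map_eq_self hs t
  rw [← ht]
  exact hext.boundary_map _

/-- Test on `rel C → pull C → C`. Here `K2 (susp (pull C))` vanishes, so the boundary is injective;
it factors through `K2 (suspToRel C)`. -/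
theorem exactSecond_of_exact_quotient (h : ∀ (A' B' : NormalPair.{u}) (i' : Hom A' B')
    (p' : Hom B' C) (h' : IsExtension i' p') (δ : KJ 1 C →* KJ 0 A'), IsBoundary h' 0 δ →
    B'.ExactFirst → Function.MulExact (KJ.map 1 p') δ) : C.ExactSecond := by
  have hext := isExtension_pullEv C
  have hex : Function.MulExact (K2.map (pullEv C).susp) hext.boundary :=
    h _ _ _ _ hext hext.boundary hext.boundary_cone (by
      rw [exactFirst_iff]
      intro x _
      refine ⟨1, ?_⟩
      rw [map_one, K2.eq_one_of_free (A := rel (pull C)) UGrp.ev UGrp.ev_surjective rfl x])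
  rw [exactSecond_iff, injective_iff_map_eq_one]
  intro t ht
  obtain ⟨z, rfl⟩ := (hex t).mp (by
    rw [hext.boundary_eq (y := 1), map_one]
    rw [map_one]
    exact ht.symm)
  have hz : z = 1 := K2.susp_eq_one (pull C) z
  rw [hz, map_one]

/-- For `N = F` the group `U_{F/N}` is trivial, whence `J_{N,F} = J_F`. -/
theorem bijective_suspToRel (hA : A.N = ⊤) : Function.Bijective (K2.map (suspToRel A)) := by
  refine K2.map_bijective_of_bijective Function.bijective_id fun w hw => ⟨?_, hw⟩
  have : UGrp.map (QuotientGroup.mk' A.N) = 1 := UGrp.hom_ext fun x => by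
    have hx : QuotientGroup.mk' A.N x = 1 := (QuotientGroup.eq_one_iff x).mpr (hA ▸ trivial)
    rw [UGrp.map_u, hx, UGrp.u_one]
    rfl
  exact DFunLike.congr_fun this w

/-- The extension `(N,F) → (F,F) → (F/N,F/N)`. -/
theorem exists_isExtension_top (A : NormalPair.{u}) :
    ∃ (B C : NormalPair.{u}) (i : Hom A B) (p : Hom B C),
      IsExtension i p ∧ B.N = ⊤ ∧ C.N = ⊤ := by
  let B : NormalPair.{u} := ⟨A.G, ⊤⟩
  let i : Hom A B := ⟨MonoidHom.id A.G, fun x _ => Subgroup.mem_top x⟩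
  obtain ⟨C, p, h⟩ := exists_isExtension i Function.bijective_id
  refine ⟨B, C, i, p, h, rfl, ?_⟩
  rw [← h.map_eq]
  exact Subgroup.map_top_of_surjective _ h.surjective

/-- For the extension of `(F/N, F/N)` by `(N,F)`, the last two suspensions are the `rel` pairs.
Exactness at the middle suspension is then exactness of `K2 (susp A) → K2 (rel A) → K2 (pull A)`. -/
theorem exactFirst_of_exact_kernel (h : ∀ (B' C' : NormalPair.{u}) (i' : Hom A B')
    (p' : Hom B' C'), IsExtension i' p' → B'.ExactSecond →
    Function.MulExact (KJ.map 1 i') (KJ.map 1 p')) : A.ExactFirst := by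
  obtain ⟨B, C, i, p, hext, hB, hC⟩ := exists_isExtension_top A
  have hex : Function.MulExact (K2.map i.susp) (K2.map p.susp) :=
    h B C i p hext ((exactSecond_iff B).mpr (bijective_suspToRel hB).1)
  rw [exactFirst_iff]
  intro y hy
  obtain ⟨x, hx⟩ := (bijective_suspToRel hB).2 (K2.map i.rel y)
  obtain ⟨z, hz⟩ := (hex x).mp (by
    apply (bijective_suspToRel hC).1
    rw [p.map_suspToRel, hx, ← hext.map_pullToRel_relToPull, hy, map_one, map_one])
  refine ⟨z, (i.bijective_rel hext.bijective).1 ?_⟩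
  rw [← i.map_suspToRel, ← hx, ← hz]

theorem exactSecond_of_exact_kernel (h : ∀ (B' C' : NormalPair.{u}) (i' : Hom A B')
    (p' : Hom B' C') (h' : IsExtension i' p') (δ : KJ 2 C' →* KJ 1 A), IsBoundary h' 1 δ →
    Function.MulExact δ (KJ.map 1 i')) : A.ExactSecond := by
  obtain ⟨B, C, i, p, hext, hB, -⟩ := exists_isExtension_top A
  have hex : Function.MulExact (1 : K2 (susp (susp C)) →* K2 (susp A)) (K2.map i.susp) :=
    h B C i p hext 1 (hext.isBoundary_succ 0)
  rw [exactSecond_iff, injective_iff_map_eq_one]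
  intro x hx
  obtain ⟨t, ht⟩ := (hex x).mp (by
    apply (bijective_suspToRel hB).1
    rw [i.map_suspToRel, hx, map_one, map_one])
  exact ht.symm

/-! ### Assembly of the long exact sequence -/

/-- The boundary maps `K^J_{k+3}(P,E) → K^J_{k+2}(N,F)`. -/
noncomputable def IsExtension.boundaryKJ {i : Hom A B} {p : Hom B C} (h : IsExtension i p) :
    ∀ k : ℕ, KJ (k + 1) C →* KJ k A
  | 0 => h.boundary
  | _ + 1 => 1

theorem mulExact_of_forall_eq_one {G H K : Type*} [Group G] [Group H] [Group K]
    (hH : ∀ x : H, x = 1) (f : G →* H) (g : H →* K) : Function.MulExact f g := fun x =>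
  ⟨fun _ => ⟨1, by rw [map_one, hH x]⟩, fun _ => by rw [hH x, map_one]⟩

end NormalPair


theorem corollary5p1 {A B C : NormalPair.{u}} (i : Hom A B) (p : Hom B C) (h : IsExtension i p) :
    -- the boundary maps
    (∃ (δ : ∀ k : ℕ, KJ (k + 1) C →* KJ k A) (δ₁ : K2 C →* K1 A),
      (∀ k, IsBoundary h k (δ k)) ∧ IsBoundaryOne i p δ₁ ∧
      -- for fully exact pairs the sequence is exact at every place
      (A.FullyExact → B.FullyExact → C.FullyExact →
        (∀ k, Function.MulExact (KJ.map (k + 1) p) (δ k) ∧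
          Function.MulExact (δ k) (KJ.map k i) ∧
          Function.MulExact (KJ.map k i) (KJ.map k p)) ∧
        Function.MulExact (K2.map p) δ₁ ∧
        Function.MulExact δ₁ (K1.map i) ∧
        Function.MulExact (K1.map i) (K1.map p) ∧
        Function.Surjective (K1.map p)) ∧
      -- exactness at `K^J_2(N,F)`
      (C.ExactFirst → Function.MulExact (δ 0) (KJ.map 0 i)) ∧
      -- exactness at `K^J_3(P,E)`
      (B.ExactFirst → C.ExactSecond → Function.MulExact (KJ.map 1 p) (δ 0)) ∧
      -- exactness at `K^J_3(M,F)`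
      (A.ExactFirst → B.ExactSecond → Function.MulExact (KJ.map 1 i) (KJ.map 1 p)) ∧
      -- exactness at `K^J_3(N,F)`
      (A.ExactSecond → Function.MulExact (δ 1) (KJ.map 1 i)) ∧
      -- exactness at all other places, without any assumption
      (∀ k, Function.MulExact (KJ.map (k + 2) p) (δ (k + 1)) ∧
        Function.MulExact (δ (k + 2)) (KJ.map (k + 2) i) ∧
        Function.MulExact (KJ.map (k + 2) i) (KJ.map (k + 2) p)) ∧
      Function.MulExact (K2.map i) (K2.map p) ∧
      Function.MulExact (K2.map p) δ₁ ∧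
      Function.MulExact δ₁ (K1.map i) ∧
      Function.MulExact (K1.map i) (K1.map p) ∧
      Function.Surjective (K1.map p) ∧
      -- the splitting at `K^J_2(P,E)`
      (A.PartiallyAdmissible (A.N ⊓ (⁅B.N, (⊤ : Subgroup B.G)⁆).comap i.toHom) →
        ∃ r : K2 C →* K2 C, (∀ x, r x ∈ (K2.map p).range) ∧ ∀ x ∈ (K2.map p).range, r x = x)) ∧
    -- the conditions on the quotient pair `(P,E)` are needed: exactness at `K^J_2(N,F)`, resp. at
    -- `K^J_3(P,E)`, for all extensions with this quotient forces them
    ((∀ (A' B' : NormalPair.{u}) (i' : Hom A' B') (p' : Hom B' C) (h' : IsExtension i' p')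
        (δ : KJ 1 C →* KJ 0 A'), IsBoundary h' 0 δ →
        Function.MulExact δ (KJ.map 0 i')) → C.ExactFirst) ∧
    ((∀ (A' B' : NormalPair.{u}) (i' : Hom A' B') (p' : Hom B' C) (h' : IsExtension i' p')
        (δ : KJ 1 C →* KJ 0 A'), IsBoundary h' 0 δ → B'.ExactFirst →
        Function.MulExact (KJ.map 1 p') δ) → C.ExactSecond) ∧
    -- the conditions on the kernel pair `(N,F)` are needed: exactness at `K^J_3(M,F)`, resp. at
    -- `K^J_3(N,F)`, for all extensions with this kernel forces them
    ((∀ (B' C' : NormalPair.{u}) (i' : Hom A B') (p' : Hom B' C'), IsExtension i' p' →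
        B'.ExactSecond → Function.MulExact (KJ.map 1 i') (KJ.map 1 p')) → A.ExactFirst) ∧
    ((∀ (B' C' : NormalPair.{u}) (i' : Hom A B') (p' : Hom B' C') (h' : IsExtension i' p')
        (δ : KJ 2 C' →* KJ 1 A), IsBoundary h' 1 δ →
        Function.MulExact δ (KJ.map 1 i')) → A.ExactSecond) := by
  have hexact₁ : C.ExactFirst → Function.MulExact (h.boundaryKJ 0) (KJ.map 0 i) := fun hC =>
    h.exact_boundary_of_forall ((exactFirst_iff C).mp hC)
  have hexact₂ : B.ExactFirst → C.ExactSecond →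
      Function.MulExact (KJ.map 1 p) (h.boundaryKJ 0) := fun hB hC =>
    h.exact_map_boundary_of_forall ((exactFirst_iff B).mp hB) ((exactSecond_iff C).mp hC)
  have hexact₃ : A.ExactFirst → B.ExactSecond →
      Function.MulExact (KJ.map 1 i) (KJ.map 1 p) := fun hA hB =>
    h.exact_susp_of_forall ((exactFirst_iff A).mp hA) ((exactSecond_iff B).mp hB)
  have hexact₄ : A.ExactSecond → Function.MulExact (h.boundaryKJ 1) (KJ.map 1 i) := by
    intro hA x
    -- The source `K^J_4(P,E)` of the boundary vanishes, so exactness amounts to injectivity of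
    -- `K^J_3(N,F) → K^J_3(M,F)`.
    refine ⟨fun hx => ⟨1, ?_⟩, ?_⟩
    · have hx1 : x = 1 := h.injective_susp_of_injective ((exactSecond_iff A).mp hA)
        (hx.trans (map_one _).symm)
      rw [map_one, hx1]
    · rintro ⟨t, rfl⟩
      rw [KJ.eq_one 0 t, map_one, map_one]
  have hexact₅ : ∀ k, Function.MulExact (KJ.map (k + 2) p) (h.boundaryKJ (k + 1)) ∧
      Function.MulExact (h.boundaryKJ (k + 2)) (KJ.map (k + 2) i) ∧
      Function.MulExact (KJ.map (k + 2) i) (KJ.map (k + 2) p) := fun k =>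
    ⟨mulExact_of_forall_eq_one (KJ.eq_one k) _ _, mulExact_of_forall_eq_one (KJ.eq_one k) _ _,
      mulExact_of_forall_eq_one (KJ.eq_one k) _ _⟩
  obtain ⟨δ₁, hδ₁⟩ := h.exists_boundaryOne
  refine ⟨⟨h.boundaryKJ, δ₁, ?_, hδ₁, ?_, hexact₁, hexact₂, hexact₃, hexact₄, hexact₅,
    h.exact_K2, h.exact_K2_boundaryOne hδ₁, h.exact_boundaryOne_K1 hδ₁, h.exact_K1,
    h.K1_map_surjective, h.exists_projection⟩, exactFirst_of_exact, exactSecond_of_exact_quotient,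
    exactFirst_of_exact_kernel, exactSecond_of_exact_kernel⟩
  · rintro (_ | k)
    · exact h.boundary_cone
    · exact h.isBoundary_succ k
  · intro hA hB hC
    refine ⟨?_, h.exact_K2_boundaryOne hδ₁, h.exact_boundaryOne_K1 hδ₁, h.exact_K1,
      h.K1_map_surjective⟩
    -- The cases are the degrees `n = 2`, `n = 3` and `n ≥ 4` of `K^J_n(N,F)`. For `n = 3` the term
    -- `K^J_4(P,E)` is already trivial, hence the shifted index in `hexact₅`.
    rintro (_ | _ | k)
    · exact ⟨hexact₂ hB.1 hC.2, hexact₁ hC.1, h.exact_K2⟩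
    · exact ⟨(hexact₅ 0).1, hexact₄ hA.2, hexact₃ hA.1 hB.2⟩
    · exact ⟨(hexact₅ (k + 1)).1, (hexact₅ k).2⟩
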